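/- Let $\theta>0$, and let $G=(G_t)_{t\ge 0}$ be a centered Gaussian process with stationary increments, $G_0=0$ and almost surely continuous paths. Let $v(t)=\mathbf E[G_t^2]$, $t\ge 0$, and let $$X^\theta_t=\int_0^t e^{-\theta(t-s)}\,dG_s := G_t-\theta\int_0^t e^{-\theta(t-s)}G_s\,ds,\qquad t\ge 0,$$ be the solution of the Langevin equation $dX_t=-\theta X_t\,dt+dG_t$ with $X_0=0$. Let $\hat G=(\hat G_t)_{t\in\mathbb R}$ be an extension in law of $G$ to the whole line: a centered Gaussian process with stationary increments, $\hat G_0=0$ and almost surely continuous paths (possibly on another probability space), such that $(\hat G_t)_{t\ge 0}$ has the same law as $G$. Let $$U^\theta_t=\int_{-\infty}^t e^{-\theta(t-s)}\,d\hat G_s:=\hat G_t-\theta\int_{-\infty}^t e^{-\theta(t-s)}\hat G_s\,ds$$ be the stationary solution, with autocovariance function $r_\theta(t)=\operatorname{Cov}(U^\theta_t,U^\theta_0)$. Put $$\psi(\vartheta)=\frac{\vartheta}{2}\int_0^\infty e^{-\vartheta t}v(t)\,dt,\qquad \vartheta>0.$$ (Strong consistency) Assume that $$\lim_{T\to\infty}\frac1T\int_0^T|r_\theta(t)|\,dt=0$$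 and that $v$ is strictly increasing on $[0,\infty)$. Then $\psi$ is injective on $(0,\infty)$, and almost surely the following holds: for all sufficiently large $T$ the average $\frac1T\int_0^T(X^\theta_t)^2\,dt$ lies in the range $\psi((0,\infty))$, so that the alternative estimator $$\tilde\theta_T=\psi^{-1}\!\left(\frac1T\int_0^T (X^\theta_t)^2\,dt\right)$$ is well defined, and $\tilde\theta_T\to\theta$ as $T\to\infty$. -/

import Mathlib

open MeasureTheory ProbabilityTheory Filter Topology Set
open scoped NNReal

noncomputable section

/-- A process `G` has stationary increments: for every shift `h`, the process
`(G (h + t) - G h)_t` has the same finite-dimensional laws as `(G t - G 0)_t`. -/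
def HasStationaryIncrements {S Ω : Type*} [AddMonoid S] [MeasurableSpace Ω]
    (G : S → Ω → ℝ) (P : Measure Ω) : Prop :=
  ∀ (h : S) (I : Finset S),
    IdentDistrib (fun ω ↦ I.restrict (fun t ↦ G (h + t) ω - G h ω))
      (fun ω ↦ I.restrict (fun t ↦ G t ω - G 0 ω)) P P

/-- `G` is a centered Gaussian process with stationary increments, started at `0`, with (almost
surely) continuous paths. The time set `S` is `ℝ≥0` (noise of the Langevin equation) or `ℝ`
(noise extended to the negative half-line). -/
structure IsGaussianNoise {S Ω : Type*} [AddMonoid S] [TopologicalSpace S] [MeasurableSpace Ω]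
    (G : S → Ω → ℝ) (P : Measure Ω) : Prop where
  gaussian : IsGaussianProcess G P
  centered : ∀ t, ∫ ω, G t ω ∂P = 0
  start_zero : ∀ᵐ ω ∂P, G 0 ω = 0
  stationary : HasStationaryIncrements G P
  continuous : ∀ᵐ ω ∂P, Continuous (fun t ↦ G t ω)

/-- `G'` (possibly living on another probability space) is an extension in law of the noise `G` to
the whole line, again a continuous centered Gaussian process with stationary increments. -/
structure IsNoiseExtension {Ω Ω' : Type*} [MeasurableSpace Ω] [MeasurableSpace Ω']
    (G : ℝ≥0 → Ω → ℝ) (P : Measure Ω) (G' : ℝ → Ω' → ℝ) (P' : Measure Ω') : Prop where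
  noise : IsGaussianNoise G' P'
  law_eq : ∀ I : Finset ℝ≥0,
    IdentDistrib (fun ω ↦ I.restrict (fun t ↦ G t ω))
      (fun ω' ↦ I.restrict (fun t : ℝ≥0 ↦ G' (t : ℝ) ω')) P P'

/-- The variance function `v t` of the noise, `t ≥ 0`. -/
def noiseVariance {Ω : Type*} [MeasurableSpace Ω] (G : ℝ≥0 → Ω → ℝ) (P : Measure Ω)
    (t : ℝ≥0) : ℝ :=
  variance (G t) P

/-- The solution `U^{θ,ξ}_t = e^{-θ t} ξ + ∫_0^t e^{-θ (t - s)} dG_s`, `t ≥ 0`, of the Langevin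
equation `dU = -θ U dt + dG`, `U_0 = ξ`, the integral being defined pathwise through integration
by parts as `G_t - θ ∫_0^t e^{-θ (t - s)} G_s ds`. -/
def langevinSolution {Ω : Type*} (θ : ℝ) (G : ℝ≥0 → Ω → ℝ) (ξ : Ω → ℝ) (t : ℝ) (ω : Ω) : ℝ :=
  Real.exp (-θ * t) * ξ ω +
    (G t.toNNReal ω - θ * ∫ s in (0 : ℝ)..t, Real.exp (-θ * (t - s)) * G s.toNNReal ω)

/-- The solution `X^θ = U^{θ,0}` started from zero. -/
def zeroSolution {Ω : Type*} (θ : ℝ) (G : ℝ≥0 → Ω → ℝ) : ℝ → Ω → ℝ :=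
  langevinSolution θ G (fun _ ↦ 0)

/-- The stationary solution `U^θ_t = ∫_{-∞}^t e^{-θ (t - s)} dG'_s` for a noise `G'` on the whole
line, the integral being defined pathwise through integration by parts as
`G'_t - θ ∫_{-∞}^t e^{-θ (t - s)} G'_s ds`. -/
def stationarySolution {Ω' : Type*} (θ : ℝ) (G' : ℝ → Ω' → ℝ) (t : ℝ) (ω' : Ω') : ℝ :=
  G' t ω' - θ * ∫ s in Iic t, Real.exp (-θ * (t - s)) * G' s ω'

/-- The autocovariance function `r_θ` of the stationary solution. -/
def stationaryAutocov {Ω' : Type*} [MeasurableSpace Ω'] (θ : ℝ) (G' : ℝ → Ω' → ℝ)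
    (P' : Measure Ω') (t : ℝ) : ℝ :=
  covariance (stationarySolution θ G' t) (stationarySolution θ G' 0) P'

/-- `ψ(θ) = (θ / 2) ∫_0^∞ e^{-θ t} v(t) dt`. -/
def psi (v : ℝ≥0 → ℝ) (θ : ℝ) : ℝ :=
  θ / 2 * ∫ t in Ioi (0 : ℝ), Real.exp (-θ * t) * v t.toNNReal

/-- The time average `(1 / T) ∫_0^T (X^θ_t)² dt` of the squared observations. -/
def meanSquare {Ω : Type*} (θ : ℝ) (G : ℝ≥0 → Ω → ℝ) (T : ℝ) (ω : Ω) : ℝ :=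
  1 / T * ∫ t in (0 : ℝ)..T, zeroSolution θ G t ω ^ 2

/-- The alternative estimator `ψ⁻¹((1 / T) ∫_0^T (X^θ_t)² dt)`, where `ψ⁻¹` is the inverse of `ψ`
on `(0, ∞)` (with an arbitrary value outside the range of `ψ`). -/
def alternativeEstimator {Ω : Type*} [MeasurableSpace Ω] (θ : ℝ) (G : ℝ≥0 → Ω → ℝ)
    (P : Measure Ω) (T : ℝ) (ω : Ω) : ℝ :=
  Function.invFunOn (psi (noiseVariance G P)) (Ioi 0) (meanSquare θ G T ω)

end

/-!
The estimator is consistent because the averages `(1 / T) ∫_0^T X_t² dt` converge almost surely to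
`ψ(θ)`, and because `ψ` is a homeomorphism from `(0, ∞)` onto its range: after a change of variables
`ψ(θ) = ½ ∫ e^{-u} v(u / θ) du`, which is strictly decreasing and continuous in `θ`
(`strictAntiOn_psi`, `continuousOn_psi`, `tendsto_invFunOn_of_strictAntiOn`).

The convergence is proved on the space of continuous paths, under the law `μ` of the two-sided
noise. Stationarity of the increments means that the shifts `f ↦ f (h + ·) - f h` preserve `μ`. The
stationary solution is the functional `U_t = ∫ (f t - f (t - a)) θ e^{-θ a} da` of the increments, and
`U_{h + t}` is `U_t` composed with the shift by `h`. Its variance is `ψ(θ)`: with independent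
exponential variables `a, b`, the covariance of the increments over `[t - a, t]` and `[t - b, t]` is
`(v(a) + v(b) - v(|a - b|)) / 2`, and `|a - b|` is distributed as `a`
(`integral_sq_stationaryPath`).

The variables `U_t` belong to the closed linear span of the noise in `L²`, hence they are jointly
Gaussian and `Cov(U_t², U_s²) = 2 r(t - s)²` (`MemClosedSpan.integral_sq_mul_sq`). The variance of
`(1 / K) ∫_0^K U_t² dt` is therefore at most `4 r(0) (1 / K) ∫_0^K |r|`, which tends to zero. This
convergence in `L²` is upgraded to almost sure convergence by a form of the pointwise ergodic theorem,
`ae_tendsto_birkhoffAverage_of_tendsto_integral_sq`: replacing `f` by one of its Birkhoff averages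
`A_K f` does not change the limit along almost every orbit, while the maximal inequality bounds the
oscillation of the averages of `A_K f` by the norm of `A_K f - c`, which is small for large `K`.

Finally `X_t = U_t - e^{-θ t} U_0` has the same quadratic averages as `U_t`, and for continuous
paths their convergence is a measurable event, so it passes from the law of the extended noise to that
of the noise itself.
-/

/-! ### The pointwise ergodic theorem -/

/-- The running maximum `max (0, S₁ f, …, S_N f)` of the Birkhoff sums of `f`, written through the
recursion `M_{N+1} = max (0, f + M_N ∘ T)`. -/
def birkhoffMax {X : Type*} (T : X → X) (f : X → ℝ) : ℕ → X → ℝ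
  | 0, _ => 0
  | N + 1, x => max 0 (f x + birkhoffMax T f N (T x))

section Birkhoff

variable {X : Type*} {T : X → X} {f : X → ℝ}

lemma birkhoffMax_nonneg (N : ℕ) (x : X) : 0 ≤ birkhoffMax T f N x := by
  cases N with
  | zero => simp [birkhoffMax]
  | succ N => simp [birkhoffMax]

lemma birkhoffMax_le_succ (N : ℕ) (x : X) : birkhoffMax T f N x ≤ birkhoffMax T f (N + 1) x := by
  induction N generalizing x with
  | zero => simp [birkhoffMax]
  | succ N ih => exact max_le_max le_rfl (by linarith [ih (T x)])

lemma birkhoffSum_le_birkhoffMax (N : ℕ) (x : X) :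
    birkhoffSum T f N x ≤ birkhoffMax T f N x := by
  induction N generalizing x with
  | zero => simp [birkhoffMax]
  | succ N ih =>
    rw [birkhoffSum_succ']
    exact le_max_of_le_right (by linarith [ih (T x)])

lemma birkhoffMax_le_add (N : ℕ) (x : X) (h : 0 < birkhoffMax T f N x) :
    birkhoffMax T f N x ≤ f x + birkhoffMax T f N (T x) := by
  cases N with
  | zero => simp [birkhoffMax] at h
  | succ N =>
    have h1 := birkhoffMax_le_succ (T := T) (f := f) N (T x)
    have h2 : birkhoffMax T f (N + 1) x = max 0 (f x + birkhoffMax T f N (T x)) := rfl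
    rcases max_cases 0 (f x + birkhoffMax T f N (T x)) with h3 | h3 <;> linarith

/-- Averaging over the first `K` iterates does not change the asymptotics of Birkhoff averages along
an orbit of sublinear growth. -/
lemma tendsto_birkhoffAverage_birkhoffAverage_sub {x : X}
    (hx : Tendsto (fun n : ℕ ↦ f (T^[n] x) / n) atTop (𝓝 0)) {K : ℕ} (hK : K ≠ 0) :
    Tendsto (fun n ↦ birkhoffAverage ℝ T (birkhoffAverage ℝ T f K) n x -
      birkhoffAverage ℝ T f n x) atTop (𝓝 0) := by
  have hstep (k : ℕ) : Tendsto (fun n : ℕ ↦ f (T^[n + k] x) / n) atTop (𝓝 0) := by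
    have h1 : Tendsto (fun n : ℕ ↦ f (T^[n + k] x) / ((n + k : ℕ) : ℝ)) atTop (𝓝 0) :=
      hx.comp (tendsto_add_atTop_nat k)
    have h2 : Tendsto (fun n : ℕ ↦ 1 + (k : ℝ) / n) atTop (𝓝 (1 + 0)) :=
      tendsto_const_nhds.add (tendsto_const_div_atTop_nhds_zero_nat _)
    have h3 := h1.mul h2
    rw [zero_mul] at h3
    refine h3.congr' ?_
    filter_upwards [eventually_gt_atTop 0] with n hn
    have : (0 : ℝ) < n := by exact_mod_cast hn
    push_cast
    field_simp
  have hk (k : ℕ) : Tendsto (fun n ↦ birkhoffAverage ℝ T f n (T^[k] x) -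
      birkhoffAverage ℝ T f n x) atTop (𝓝 0) := by
    induction k with
    | zero => simp
    | succ k ih =>
      have h1 : Tendsto (fun n ↦ birkhoffAverage ℝ T f n (T^[k + 1] x) -
          birkhoffAverage ℝ T f n (T^[k] x)) atTop (𝓝 0) := by
        have h2 := (hstep k).sub (tendsto_const_div_atTop_nhds_zero_nat (f (T^[k] x)))
        rw [sub_zero] at h2
        refine h2.congr fun n ↦ ?_
        rw [Function.iterate_succ_apply', birkhoffAverage_apply_sub_birkhoffAverage,
          ← Function.iterate_add_apply, smul_eq_mul]
        ring
      simpa using h1.add ih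
  have hsum := (tendsto_finsetSum (Finset.range K) fun k _ ↦ hk k).const_mul (K : ℝ)⁻¹
  simp only [Finset.sum_const_zero, mul_zero] at hsum
  refine hsum.congr fun n ↦ ?_
  have hK' : (K : ℝ) ≠ 0 := by exact_mod_cast hK
  rw [Finset.sum_sub_distrib, Finset.sum_const, Finset.card_range, nsmul_eq_mul, mul_sub,
    inv_mul_cancel_left₀ hK']
  congr 1
  simp only [birkhoffAverage, birkhoffSum, smul_eq_mul, Finset.mul_sum]
  rw [Finset.sum_comm]
  refine Finset.sum_congr rfl fun i _ ↦ Finset.sum_congr rfl fun j _ ↦ ?_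
  rw [← Function.iterate_add_apply, ← Function.iterate_add_apply, add_comm]
  ring

variable [MeasurableSpace X] {μ : Measure X}

lemma integrable_birkhoffMax (hT : MeasurePreserving T μ μ) (hf : Integrable f μ) (N : ℕ) :
    Integrable (birkhoffMax T f N) μ := by
  induction N with
  | zero => exact integrable_zero _ _ _
  | succ N ih =>
    exact (integrable_zero _ _ _).sup (hf.add (hT.integrable_comp_of_integrable ih))

lemma measurable_birkhoffMax (hT : Measurable T) (hf : Measurable f) (N : ℕ) :
    Measurable (birkhoffMax T f N) := by
  induction N with
  | zero => exact measurable_const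
  | succ N ih => exact measurable_const.max (hf.add (ih.comp hT))

/-- The maximal ergodic theorem, by Garsia's argument: on `{0 < M}` one has `M - M ∘ T ≤ f`, and
`M - M ∘ T` has integral zero. -/
lemma setIntegral_birkhoffMax_pos_nonneg (hT : MeasurePreserving T μ μ) (hf : Integrable f μ)
    (hfm : Measurable f) (N : ℕ) :
    0 ≤ ∫ x in {x | 0 < birkhoffMax T f N x}, f x ∂μ := by
  set M := birkhoffMax T f N
  have hM : Integrable M μ := integrable_birkhoffMax hT hf N
  have hMm : Measurable M := measurable_birkhoffMax hT.measurable hfm N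
  have hMT : Integrable (fun x ↦ M (T x)) μ := hT.integrable_comp_of_integrable hM
  have hs : MeasurableSet {x | 0 < M x} := measurableSet_lt measurable_const hMm
  have h1 : ∫ x, M (T x) ∂μ = ∫ x, M x ∂μ := by
    conv_rhs => rw [← hT.map_eq]
    rw [integral_map hT.aemeasurable]
    exact hMm.aestronglyMeasurable
  have h2 : ∫ x, (M x - M (T x)) ∂μ ≤ ∫ x, {x | 0 < M x}.indicator f x ∂μ := by
    refine integral_mono (hM.sub hMT) (hf.indicator hs) fun x ↦ ?_
    by_cases hx : 0 < M x
    · rw [indicator_of_mem (by exact hx)]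
      linarith [birkhoffMax_le_add N x hx]
    · rw [indicator_of_notMem (by exact hx)]
      linarith [birkhoffMax_nonneg (T := T) (f := f) N (T x)]
  rw [integral_sub hM hMT, h1, sub_self, integral_indicator hs] at h2
  exact h2

/-- The weak type `(1, 1)` bound for the maximal function of the Birkhoff averages. -/
lemma measureReal_exists_birkhoffAverage_gt_le [IsFiniteMeasure μ] (hT : MeasurePreserving T μ μ)
    (hf : Integrable f μ) (hfm : Measurable f) {c : ℝ} (hc : 0 < c) :
    μ.real {x | ∃ n, c < birkhoffAverage ℝ T (fun y ↦ |f y|) n x} ≤ (∫ x, |f x| ∂μ) / c := by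
  set g : X → ℝ := fun x ↦ |f x| - c
  have hg : Integrable g μ := hf.abs.sub (integrable_const c)
  have hgm : Measurable g := (measurable_norm.comp hfm).sub_const c
  set E : ℕ → Set X := fun N ↦ {x | 0 < birkhoffMax T g N x}
  have hEmono : Monotone E := monotone_nat_of_le_succ fun N x hx ↦
    lt_of_lt_of_le hx (birkhoffMax_le_succ N x)
  have hE (N : ℕ) : μ.real (E N) ≤ (∫ x, |f x| ∂μ) / c := by
    have hs : MeasurableSet (E N) :=
      measurableSet_lt measurable_const (measurable_birkhoffMax hT.measurable hgm N)
    have h1 := setIntegral_birkhoffMax_pos_nonneg hT hg hgm N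
    have h2 : ∫ x in E N, g x ∂μ = ∫ x in E N, |f x| ∂μ - μ.real (E N) * c := by
      rw [integral_sub hf.abs.integrableOn (integrable_const c)]
      simp
    have h3 : ∫ x in E N, |f x| ∂μ ≤ ∫ x, |f x| ∂μ :=
      setIntegral_le_integral hf.abs (ae_of_all _ fun x ↦ abs_nonneg _)
    rw [le_div_iff₀ hc]
    linarith [h2 ▸ h1]
  have hsub : {x | ∃ n, c < birkhoffAverage ℝ T (fun y ↦ |f y|) n x} ⊆ ⋃ N, E N := by
    rintro x ⟨n, hn⟩
    refine mem_iUnion.2 ⟨n, lt_of_lt_of_le ?_ (birkhoffSum_le_birkhoffMax n x)⟩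
    have hn0 : n ≠ 0 := by
      rintro rfl
      simp at hn
      linarith
    have hn1 : (0 : ℝ) < n := by positivity
    have h4 : birkhoffSum T g n x = birkhoffSum T (fun y ↦ |f y|) n x - n * c := by
      simp [birkhoffSum, g, Finset.sum_sub_distrib]
    rw [birkhoffAverage, smul_eq_mul, inv_mul_eq_div, lt_div_iff₀ hn1] at hn
    rw [h4]
    linarith
  refine (measureReal_mono hsub).trans ?_
  refine le_of_tendsto ((ENNReal.tendsto_toReal (measure_ne_top μ _)).comp
    (tendsto_measure_iUnion_atTop hEmono)) (Eventually.of_forall hE)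

/-- Along almost every orbit, a square integrable function grows more slowly than `n`, because
`∑ f(Tⁿ x)² / n²` has finite expectation. -/
lemma ae_tendsto_iterate_div [IsFiniteMeasure μ] (hT : MeasurePreserving T μ μ)
    (hf : MemLp f 2 μ) (hfm : Measurable f) :
    ∀ᵐ x ∂μ, Tendsto (fun n : ℕ ↦ f (T^[n] x) / n) atTop (𝓝 0) := by
  have hsum : ∑' n : ℕ, ∫⁻ x, ENNReal.ofReal ((f (T^[n] x) / n) ^ 2) ∂μ ≠ ⊤ := by
    have h1 (n : ℕ) : ∫⁻ x, ENNReal.ofReal ((f (T^[n] x) / n) ^ 2) ∂μ =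
        ENNReal.ofReal ((∫ x, f x ^ 2 ∂μ) * (1 / (n : ℝ) ^ 2)) := by
      have h2 : Measurable fun x ↦ ENNReal.ofReal ((f x / n) ^ 2) := by fun_prop
      rw [(hT.iterate n).lintegral_comp h2, ← ofReal_integral_eq_lintegral_ofReal]
      · simp_rw [div_pow, div_eq_mul_inv]
        rw [integral_mul_const]
        simp
      · simp_rw [div_pow]
        exact hf.integrable_sq.div_const _
      · exact ae_of_all _ fun x ↦ sq_nonneg _
    simp_rw [h1]
    have h3 : Summable fun n : ℕ ↦ (∫ x, f x ^ 2 ∂μ) * (1 / (n : ℝ) ^ 2) :=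
      (Real.summable_one_div_nat_pow.2 one_lt_two).mul_left _
    exact h3.tsum_ofReal_ne_top
  rw [← lintegral_tsum (fun n ↦ by
    have := (hT.iterate n).measurable
    have h : Measurable fun x ↦ f (T^[n] x) := hfm.comp this
    fun_prop)] at hsum
  have hae := ae_lt_top' (AEMeasurable.tsum fun n ↦ by
    have := (hT.iterate n).measurable
    have h : Measurable fun x ↦ f (T^[n] x) := hfm.comp this
    fun_prop) hsum
  filter_upwards [hae] with x hx
  have h4 := ENNReal.tendsto_atTop_zero_of_tsum_ne_top hx.ne
  have h5 := (ENNReal.tendsto_toReal ENNReal.zero_ne_top).comp h4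
  have h6 : Tendsto (fun n : ℕ ↦ (f (T^[n] x) / n) ^ 2) atTop (𝓝 0) := by
    refine h5.congr fun n ↦ ?_
    simp [ENNReal.toReal_ofReal (sq_nonneg (f (T^[n] x) / n))]
  have h7 := h6.sqrt
  simp only [Real.sqrt_sq_eq_abs, Real.sqrt_zero] at h7
  exact tendsto_zero_iff_abs_tendsto_zero _ |>.2 h7

/-- Pointwise ergodic theorem: if the Birkhoff averages of a square integrable function
converge to a constant in `L²`, then they converge to it almost everywhere. -/
theorem ae_tendsto_birkhoffAverage_of_tendsto_integral_sq [IsProbabilityMeasure μ]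
    (hT : MeasurePreserving T μ μ) (hf : MemLp f 2 μ) (hfm : Measurable f) {c : ℝ}
    (hc : Tendsto (fun n ↦ ∫ x, (birkhoffAverage ℝ T f n x - c) ^ 2 ∂μ) atTop (𝓝 0)) :
    ∀ᵐ x ∂μ, Tendsto (fun n ↦ birkhoffAverage ℝ T f n x) atTop (𝓝 c) := by
  have hAm (n : ℕ) : Measurable (birkhoffAverage ℝ T f n) := by
    have h : Measurable fun x ↦ ∑ k ∈ Finset.range n, f (T^[k] x) :=
      Finset.measurable_fun_sum _ fun k _ ↦ hfm.comp (hT.iterate k).measurable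
    exact h.const_smul (n : ℝ)⁻¹
  have hA2 (n : ℕ) : MemLp (fun x ↦ birkhoffAverage ℝ T f n x - c) 2 μ := by
    refine MemLp.sub ?_ (memLp_const c)
    have h : MemLp (fun x ↦ ∑ k ∈ Finset.range n, f (T^[k] x)) 2 μ :=
      memLp_finsetSum _ fun k _ ↦ hf.comp_measurePreserving (hT.iterate k)
    exact h.const_smul (n : ℝ)⁻¹
  -- convergence in `L²` implies convergence in `L¹`
  have hL1 : Tendsto (fun n ↦ ∫ x, |birkhoffAverage ℝ T f n x - c| ∂μ) atTop (𝓝 0) := by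
    refine squeeze_zero (fun n ↦ integral_nonneg fun x ↦ abs_nonneg _) (fun n ↦ ?_)
      (by simpa using hc.sqrt)
    refine Real.le_sqrt_of_sq_le ?_
    have h2 : MemLp (fun x ↦ |birkhoffAverage ℝ T f n x - c|) 2 μ := (hA2 n).abs
    have h1 := variance_nonneg (fun x ↦ |birkhoffAverage ℝ T f n x - c|) μ
    rw [variance_eq_sub h2] at h1
    simp only [Pi.pow_apply, sq_abs] at h1
    linarith
  -- a point whose averages miss `c` by more than `2 ε` infinitely often lies in the set where the
  -- maximal function of `A_K f - c` exceeds `ε`, for every `K > 0`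
  have hbad (j : ℕ) : ∀ᵐ x ∂μ, ∀ᶠ n in atTop,
      |birkhoffAverage ℝ T f n x - c| ≤ 2 * (1 / ((j : ℝ) + 1)) := by
    set ε : ℝ := 1 / ((j : ℝ) + 1)
    have hε : 0 < ε := by positivity
    set g : ℕ → X → ℝ := fun K x ↦ birkhoffAverage ℝ T f K x - c
    set E : ℕ → Set X := fun K ↦ {x | ∃ n, ε < birkhoffAverage ℝ T (fun y ↦ |g K y|) n x}
    have hE (K : ℕ) : μ.real (E K) ≤ (∫ x, |g K x| ∂μ) / ε :=
      measureReal_exists_birkhoffAverage_gt_le hT ((hA2 K).integrable one_le_two)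
        ((hAm K).sub_const c) hε
    have hE0 : Tendsto (fun K ↦ μ.real (E K)) atTop (𝓝 0) :=
      squeeze_zero (fun K ↦ measureReal_nonneg) hE (by simpa using hL1.div_const ε)
    have hnull : μ.real (⋂ K ∈ Ioi 0, E K) = 0 := by
      refine le_antisymm (ge_of_tendsto hE0 ?_) measureReal_nonneg
      filter_upwards [eventually_gt_atTop 0] with K hK
      exact measureReal_mono (biInter_subset_of_mem hK)
    have hnull' : ∀ᵐ x ∂μ, x ∉ ⋂ K ∈ Ioi 0, E K :=
      measure_eq_zero_iff_ae_notMem.1 ((measureReal_eq_zero_iff).1 hnull)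
    filter_upwards [hnull', ae_tendsto_iterate_div hT hf hfm] with x hx hgrow
    simp only [mem_iInter, not_forall, mem_Ioi] at hx
    obtain ⟨K, hK, hxK⟩ := hx
    have hlim := tendsto_birkhoffAverage_birkhoffAverage_sub hgrow hK.ne'
    have hev : ∀ᶠ n in atTop, |birkhoffAverage ℝ T (birkhoffAverage ℝ T f K) n x -
        birkhoffAverage ℝ T f n x| < ε := by
      have := (tendsto_zero_iff_abs_tendsto_zero _).1 hlim
      exact this.eventually_lt_const hε
    filter_upwards [hev, eventually_gt_atTop 0] with n hn hn0
    have hn1 : (0 : ℝ) < n := by exact_mod_cast hn0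
    have h1 : birkhoffAverage ℝ T (fun y ↦ |g K y|) n x ≤ ε := by
      by_contra h
      exact hxK ⟨n, not_le.1 h⟩
    have h2 : |birkhoffAverage ℝ T (birkhoffAverage ℝ T f K) n x - c| ≤
        birkhoffAverage ℝ T (fun y ↦ |g K y|) n x := by
      have h3 : birkhoffAverage ℝ T (birkhoffAverage ℝ T f K) n x - c =
          birkhoffAverage ℝ T (g K) n x := by
        simp only [birkhoffAverage, birkhoffSum, smul_eq_mul, g, Finset.sum_sub_distrib,
          Finset.sum_const, Finset.card_range, nsmul_eq_mul, mul_sub]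
        rw [inv_mul_cancel_left₀ hn1.ne']
      rw [h3]
      simp only [birkhoffAverage, birkhoffSum, smul_eq_mul]
      rw [abs_mul, abs_of_pos (inv_pos.2 hn1)]
      exact mul_le_mul_of_nonneg_left (Finset.abs_sum_le_sum_abs _ _) (inv_pos.2 hn1).le
    have h4 := abs_le.1 (h2.trans h1)
    have h5 := abs_lt.1 hn
    exact abs_le.2 ⟨by linarith, by linarith⟩
  filter_upwards [ae_all_iff.2 hbad] with x hx
  rw [Metric.tendsto_atTop']
  intro ε hε
  obtain ⟨j, hj⟩ := exists_nat_one_div_lt (half_pos hε)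
  obtain ⟨N, hN⟩ := eventually_atTop.1 (hx j)
  refine ⟨N, fun n hn ↦ ?_⟩
  rw [Real.dist_eq]
  linarith [hN n hn.le]

end Birkhoff

/-! ### The closed linear span of a Gaussian process -/

section GaussianSpace

/-- The fourth moment, read off from the fourth derivative of the moment generating function. -/
lemma integral_pow_four_gaussianReal (v : ℝ≥0) :
    ∫ x, x ^ 4 ∂(gaussianReal 0 v) = 3 * (v : ℝ) ^ 2 := by
  have h0 : (0 : ℝ) ∈ interior (integrableExpSet id (gaussianReal 0 v)) := by
    simp
  have h1 := iteratedDeriv_mgf_zero h0 4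
  -- differentiating `p t * exp (v t² / 2)` replaces the polynomial `p` by `p' + v t p`
  have hexp (p p' : ℝ → ℝ) (hp : ∀ t, HasDerivAt p (p' t) t) :
      deriv (fun t ↦ p t * Real.exp (v * t ^ 2 / 2)) =
        fun t ↦ (p' t + v * t * p t) * Real.exp (v * t ^ 2 / 2) := by
    ext t
    have h2 : HasDerivAt (fun t : ℝ ↦ (v : ℝ) * t ^ 2 / 2) (v * t) t :=
      (((hasDerivAt_pow 2 t).const_mul (v : ℝ)).div_const 2).congr_deriv (by simp; ring)
    refine (((hp t).mul h2.exp).congr_deriv ?_).deriv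
    ring
  have hmgf : mgf id (gaussianReal 0 v) = fun t ↦ 1 * Real.exp (v * t ^ 2 / 2) := by
    simp [mgf_id_gaussianReal]
  have hd (a b c d e t : ℝ) : HasDerivAt (fun t : ℝ ↦ a + b * t + c * t ^ 2 + d * t ^ 3 + e * t ^ 4)
      (b + 2 * c * t + 3 * d * t ^ 2 + 4 * e * t ^ 3) t := by
    refine (((((hasDerivAt_id t).const_mul b).const_add a).add
      ((hasDerivAt_pow 2 t).const_mul c)).add ((hasDerivAt_pow 3 t).const_mul d)).add
      ((hasDerivAt_pow 4 t).const_mul e) |>.congr_deriv ?_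
    simp
    ring
  rw [hmgf] at h1
  simp only [iteratedDeriv_succ, iteratedDeriv_zero] at h1
  rw [hexp (fun _ ↦ 1) (fun _ ↦ 0) (fun t ↦ hasDerivAt_const t 1),
    hexp _ (fun _ ↦ v) (fun t ↦ ((hasDerivAt_id t).const_mul (v : ℝ)).congr_deriv (by simp)
      |>.congr_of_eventuallyEq (Eventually.of_forall fun s ↦ by simp)),
    hexp _ (fun t ↦ 2 * v ^ 2 * t) (fun t ↦ (hd v 0 (v ^ 2) 0 0 t).congr_deriv (by ring)
      |>.congr_of_eventuallyEq (Eventually.of_forall fun s ↦ by ring)),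
    hexp _ (fun t ↦ 3 * v ^ 2 + 3 * v ^ 3 * t ^ 2)
      (fun t ↦ (hd 0 (3 * v ^ 2) 0 (v ^ 3) 0 t).congr_deriv (by ring)
      |>.congr_of_eventuallyEq (Eventually.of_forall fun s ↦ by ring))] at h1
  simpa using h1.symm

variable {Ω : Type*} [MeasurableSpace Ω] {μ : Measure Ω} [IsProbabilityMeasure μ]

lemma norm_cexp_sub_cexp_le (a b : ℝ) :
    ‖Complex.exp (a * Complex.I) - Complex.exp (b * Complex.I)‖ ≤ |a - b| := by
  have h : Complex.exp (a * Complex.I) - Complex.exp (b * Complex.I) =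
      Complex.exp (b * Complex.I) * (Complex.exp (Complex.I * ((a - b : ℝ) : ℂ)) - 1) := by
    rw [mul_sub, ← Complex.exp_add, mul_one]
    congr 2
    push_cast
    ring
  rw [h, norm_mul, Complex.norm_exp_ofReal_mul_I, one_mul]
  exact Real.norm_exp_I_mul_ofReal_sub_one_le

lemma integrable_cexp_mul_I {f : Ω → ℝ} (hf : AEStronglyMeasurable f μ) (u : ℝ) :
    Integrable (fun ω ↦ Complex.exp ((u * f ω : ℝ) * Complex.I)) μ := by
  refine Integrable.of_bound (C := 1) ?_ (ae_of_all _ fun ω ↦ ?_)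
  · exact (Complex.continuous_exp.comp (by fun_prop :
      Continuous fun x : ℝ ↦ ((u * x : ℝ) : ℂ) * Complex.I)).comp_aestronglyMeasurable hf
  · rw [Complex.norm_exp_ofReal_mul_I]

/-- The characteristic function at `u` is Lipschitz continuous with respect to the `L²` norm. -/
lemma continuous_integral_cexp_Lp (u : ℝ) :
    Continuous fun z : Lp ℝ 2 μ ↦ ∫ ω, Complex.exp ((u * z ω : ℝ) * Complex.I) ∂μ := by
  refine (LipschitzWith.of_dist_le_mul (K := ‖u‖₊) fun z w ↦ ?_).continuous
  have hz := Lp.memLp z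
  have hw := Lp.memLp w
  rw [dist_eq_norm, dist_eq_norm, ← integral_sub (integrable_cexp_mul_I hz.1 u)
    (integrable_cexp_mul_I hw.1 u)]
  have h1 : ∫ ω, ‖(z - w : Lp ℝ 2 μ) ω‖ ∂μ ≤ ‖z - w‖ := by
    have h2 : eLpNorm (z - w : Lp ℝ 2 μ) 1 μ ≤ eLpNorm (z - w : Lp ℝ 2 μ) 2 μ :=
      eLpNorm_le_eLpNorm_of_exponent_le one_le_two (Lp.memLp (z - w)).1
    rw [integral_norm_eq_lintegral_enorm (Lp.memLp (z - w)).1, ← eLpNorm_one_eq_lintegral_enorm,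
      Lp.norm_def]
    exact ENNReal.toReal_mono (Lp.memLp (z - w)).2.ne h2
  calc ‖∫ ω, (Complex.exp ((u * z ω : ℝ) * Complex.I) -
        Complex.exp ((u * w ω : ℝ) * Complex.I)) ∂μ‖
      ≤ ∫ ω, |u| * ‖(z - w : Lp ℝ 2 μ) ω‖ ∂μ := by
        refine norm_integral_le_of_norm_le
          (((Lp.memLp (z - w)).integrable one_le_two).norm.const_mul _) ?_
        filter_upwards [Lp.coeFn_sub z w] with ω hω
        rw [hω, Pi.sub_apply]
        refine (norm_cexp_sub_cexp_le _ _).trans_eq ?_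
        rw [← mul_sub, abs_mul, Real.norm_eq_abs]
    _ ≤ |u| * ‖z - w‖ := by
        rw [integral_const_mul]
        exact mul_le_mul_of_nonneg_left h1 (abs_nonneg u)
    _ = _ := by simp

omit [IsProbabilityMeasure μ] in
lemma norm_sq_Lp_two (z : Lp ℝ 2 μ) : ‖z‖ ^ 2 = ∫ ω, z ω ^ 2 ∂μ := by
  rw [← real_inner_self_eq_norm_sq, L2.inner_def]
  simp [sq]

/-- `Z` belongs to the closed linear span of the process `X` in `L²(μ)`. Closedness is encoded by
duality: `Z` is orthogonal to whatever is orthogonal to all `X t`. -/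
def MemClosedSpan {T : Type*} (X : T → Ω → ℝ) (μ : Measure Ω) (Z : Ω → ℝ) : Prop :=
  MemLp Z 2 μ ∧ ∀ Y : Ω → ℝ, MemLp Y 2 μ → (∀ t, ∫ ω, Y ω * X t ω ∂μ = 0) →
    ∫ ω, Y ω * Z ω ∂μ = 0

namespace MemClosedSpan

variable {T : Type*} {X : T → Ω → ℝ} {Z Z' : Ω → ℝ}

omit [IsProbabilityMeasure μ] in
lemma const_mul (hZ : MemClosedSpan X μ Z) (c : ℝ) : MemClosedSpan X μ (fun ω ↦ c * Z ω) := by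
  refine ⟨hZ.1.const_mul c, fun Y hY h ↦ ?_⟩
  simp_rw [mul_left_comm]
  rw [integral_const_mul, hZ.2 Y hY h, mul_zero]

omit [IsProbabilityMeasure μ] in
lemma add (hZ : MemClosedSpan X μ Z) (hZ' : MemClosedSpan X μ Z') :
    MemClosedSpan X μ (fun ω ↦ Z ω + Z' ω) := by
  refine ⟨hZ.1.add hZ'.1, fun Y hY h ↦ ?_⟩
  simp_rw [mul_add]
  have h1 : Integrable (fun ω ↦ Y ω * Z ω) μ := hY.integrable_mul hZ.1
  have h2 : Integrable (fun ω ↦ Y ω * Z' ω) μ := hY.integrable_mul hZ'.1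
  rw [integral_add h1 h2, hZ.2 Y hY h, hZ'.2 Y hY h, add_zero]

lemma integral_eq_zero (hX : ∀ t, ∫ ω, X t ω ∂μ = 0) (hZ : MemClosedSpan X μ Z) :
    ∫ ω, Z ω ∂μ = 0 := by
  simpa using hZ.2 (fun _ ↦ 1) (memLp_const 1) (by simpa using hX)

/-- The closed linear span in `L²` of a centered Gaussian process consists of centered Gaussian
variables: finite linear combinations are Gaussian, and the identity `E e^{iuz} = e^{-u²‖z‖²/2}`
survives limits in `L²`. -/
theorem map_eq_gaussianReal (hX : IsGaussianProcess X μ) (hc : ∀ t, ∫ ω, X t ω ∂μ = 0)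
    (hZ : MemClosedSpan X μ Z) : μ.map Z = gaussianReal 0 (∫ ω, Z ω ^ 2 ∂μ).toNNReal := by
  have hX2 (t : T) : MemLp (X t) 2 μ := (hX.hasGaussianLaw_eval t).memLp_two
  set H : Submodule ℝ (Lp ℝ 2 μ) := Submodule.span ℝ (Set.range fun t ↦ (hX2 t).toLp (X t))
  set z : Lp ℝ 2 μ := hZ.1.toLp Z
  -- the closure of `H` is its double orthogonal complement
  have hz : z ∈ H.topologicalClosure := by
    rw [← Submodule.orthogonal_orthogonal_eq_closure, Submodule.mem_orthogonal]
    intro y hy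
    have h1 (t : T) : ∫ ω, y ω * X t ω ∂μ = 0 := by
      have h2 := (Submodule.mem_orthogonal _ _).1 hy _ (Submodule.subset_span ⟨t, rfl⟩)
      rw [L2.inner_def] at h2
      rw [← h2]
      refine integral_congr_ae ?_
      filter_upwards [(hX2 t).coeFn_toLp] with ω hω
      simp [hω]
    rw [L2.inner_def, ← hZ.2 y (Lp.memLp y) h1]
    refine integral_congr_ae ?_
    filter_upwards [hZ.1.coeFn_toLp] with ω hω
    simp [z, hω, mul_comm]
  have hclosed (u : ℝ) : IsClosed {w : Lp ℝ 2 μ |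
      ∫ ω, Complex.exp ((u * w ω : ℝ) * Complex.I) ∂μ =
        Complex.exp ((-(‖w‖ ^ 2 * u ^ 2 / 2) : ℝ) : ℂ)} :=
    isClosed_eq (continuous_integral_cexp_Lp u) (by fun_prop)
  have hspan (u : ℝ) : (H : Set (Lp ℝ 2 μ)) ⊆ {w : Lp ℝ 2 μ |
      ∫ ω, Complex.exp ((u * w ω : ℝ) * Complex.I) ∂μ =
        Complex.exp ((-(‖w‖ ^ 2 * u ^ 2 / 2) : ℝ) : ℂ)} := by
    intro w hw
    obtain ⟨c, hcw⟩ := Finsupp.mem_span_range_iff_exists_finsupp.1 hw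
    set W : Ω → ℝ := fun ω ↦ ∑ t ∈ c.support, c t • X t ω
    have hwW : w =ᵐ[μ] W := by
      have h3 : ∀ᵐ ω ∂μ, ∀ t ∈ c.support,
          (c t • (hX2 t).toLp (X t) : Lp ℝ 2 μ) ω = c t • X t ω := by
        refine (Finset.eventually_all _).2 fun t _ ↦ ?_
        filter_upwards [Lp.coeFn_smul (c t) ((hX2 t).toLp (X t)), (hX2 t).coeFn_toLp] with ω h4 h5
        rw [h4, Pi.smul_apply, h5]
      rw [← hcw, Finsupp.sum]
      filter_upwards [Lp.coeFn_finsetSum c.support fun t ↦ c t • (hX2 t).toLp (X t), h3]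
        with ω h4 h5
      rw [h4, Finset.sum_apply]
      exact Finset.sum_congr rfl h5
    have hWg : HasGaussianLaw W μ := (hX.smul fun t ↦ c t).hasGaussianLaw_fun_sum
    have hW0 : ∫ ω, W ω ∂μ = 0 := by
      have h10 (t : T) : Integrable (fun ω ↦ c t • X t ω) μ :=
        ((hX2 t).integrable one_le_two).smul (c t)
      rw [integral_finsetSum _ fun t _ ↦ h10 t]
      refine Finset.sum_eq_zero fun t _ ↦ ?_
      rw [integral_smul, hc t, smul_zero]
    have hWn : Var[W; μ] = ‖w‖ ^ 2 := by
      rw [variance_of_integral_eq_zero hWg.aemeasurable hW0, norm_sq_Lp_two]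
      exact integral_congr_ae (by filter_upwards [hwW] with ω h6; rw [h6])
    have h7 : charFun (μ.map W) u = Complex.exp ((-(‖w‖ ^ 2 * u ^ 2 / 2) : ℝ) : ℂ) := by
      rw [hWg.map_eq_gaussianReal, charFun_gaussianReal, hW0, hWn,
        Real.coe_toNNReal _ (sq_nonneg _)]
      push_cast
      ring_nf
    rw [mem_ofPred_eq, ← h7, charFun_apply_real, integral_map hWg.aemeasurable (by fun_prop)]
    refine integral_congr_ae ?_
    filter_upwards [hwW] with ω h6
    rw [h6]
    push_cast
    rfl
  have hZm : AEMeasurable Z μ := hZ.1.aestronglyMeasurable.aemeasurable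
  have : IsProbabilityMeasure (μ.map Z) := Measure.isProbabilityMeasure_map hZm
  refine Measure.ext_of_charFun ?_
  ext u
  have h8 := closure_minimal (hspan u) (hclosed u) hz
  have hzZ : z =ᵐ[μ] Z := hZ.1.coeFn_toLp
  have h9 : ‖z‖ ^ 2 = ∫ ω, Z ω ^ 2 ∂μ := by
    rw [norm_sq_Lp_two]
    exact integral_congr_ae (by filter_upwards [hzZ] with ω h6; rw [h6])
  rw [charFun_gaussianReal, charFun_apply_real, integral_map hZm (by fun_prop)]
  rw [mem_ofPred_eq, h9] at h8
  calc ∫ ω, Complex.exp (u * Z ω * Complex.I) ∂μ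
      = ∫ ω, Complex.exp ((u * z ω : ℝ) * Complex.I) ∂μ := by
        refine integral_congr_ae ?_
        filter_upwards [hzZ] with ω h6
        rw [h6]
        push_cast
        rfl
    _ = _ := by
        rw [h8, Real.coe_toNNReal _ (integral_nonneg fun ω ↦ sq_nonneg _)]
        push_cast
        ring_nf

lemma memLp_four (hX : IsGaussianProcess X μ) (hc : ∀ t, ∫ ω, X t ω ∂μ = 0)
    (hZ : MemClosedSpan X μ Z) : MemLp Z 4 μ := by
  have hZm : AEMeasurable Z μ := hZ.1.aestronglyMeasurable.aemeasurable
  have h : MemLp id 4 (μ.map Z) := by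
    rw [hZ.map_eq_gaussianReal hX hc]
    exact memLp_id_gaussianReal' 4 (by simp)
  exact (memLp_map_measure_iff h.1 hZm).1 h

lemma integral_pow_four (hX : IsGaussianProcess X μ) (hc : ∀ t, ∫ ω, X t ω ∂μ = 0)
    (hZ : MemClosedSpan X μ Z) : ∫ ω, Z ω ^ 4 ∂μ = 3 * (∫ ω, Z ω ^ 2 ∂μ) ^ 2 := by
  have hZm : AEMeasurable Z μ := hZ.1.aestronglyMeasurable.aemeasurable
  have h := integral_pow_four_gaussianReal (∫ ω, Z ω ^ 2 ∂μ).toNNReal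
  rw [← hZ.map_eq_gaussianReal hX hc, integral_map hZm (by fun_prop),
    Real.coe_toNNReal _ (integral_nonneg fun ω ↦ sq_nonneg _)] at h
  exact h

lemma integrable_pow_four (hX : IsGaussianProcess X μ) (hc : ∀ t, ∫ ω, X t ω ∂μ = 0)
    (hZ : MemClosedSpan X μ Z) : Integrable (fun ω ↦ Z ω ^ 4) μ := by
  have h := (hZ.memLp_four hX hc).integrable_norm_pow (by norm_num)
  refine h.congr (ae_of_all _ fun ω ↦ ?_)
  change ‖Z ω‖ ^ 4 = Z ω ^ 4
  rw [Real.norm_eq_abs, Even.pow_abs (by decide)]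

/-- Isserlis' formula for `E[Z² Z'²]`, obtained from the fourth moments of `Z + Z'`, `Z - Z'` by
polarization. -/
theorem integral_sq_mul_sq (hX : IsGaussianProcess X μ) (hc : ∀ t, ∫ ω, X t ω ∂μ = 0)
    (hZ : MemClosedSpan X μ Z) (hZ' : MemClosedSpan X μ Z') :
    Integrable (fun ω ↦ Z ω ^ 2 * Z' ω ^ 2) μ ∧
    ∫ ω, Z ω ^ 2 * Z' ω ^ 2 ∂μ =
      (∫ ω, Z ω ^ 2 ∂μ) * (∫ ω, Z' ω ^ 2 ∂μ) + 2 * (∫ ω, Z ω * Z' ω ∂μ) ^ 2 := by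
  have hp := hZ.add hZ'
  have hm := hZ.add (hZ'.const_mul (-1))
  have i1 := hp.integrable_pow_four hX hc
  have i2 := hm.integrable_pow_four hX hc
  have i3 := hZ.integrable_pow_four hX hc
  have i4 := hZ'.integrable_pow_four hX hc
  have e1 := hp.integral_pow_four hX hc
  have e2 := hm.integral_pow_four hX hc
  have e3 := hZ.integral_pow_four hX hc
  have e4 := hZ'.integral_pow_four hX hc
  have j1 := hZ.1.integrable_sq
  have j2 := hZ'.1.integrable_sq
  have j3 : Integrable (fun ω ↦ Z ω * Z' ω) μ := hZ.1.integrable_mul hZ'.1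
  have hpol : (fun ω ↦ Z ω ^ 2 * Z' ω ^ 2) = fun ω ↦ (1 / 12 : ℝ) *
      (((Z ω + Z' ω) ^ 4 + (Z ω + -1 * Z' ω) ^ 4) - 2 * (Z ω ^ 4 + Z' ω ^ 4)) := by
    ext ω
    ring
  have hsq (s : ℝ) (hs : s ^ 2 = 1) : ∫ ω, (Z ω + s * Z' ω) ^ 2 ∂μ =
      ∫ ω, Z ω ^ 2 ∂μ + ∫ ω, Z' ω ^ 2 ∂μ + 2 * s * ∫ ω, Z ω * Z' ω ∂μ := by
    have j4 : Integrable (fun ω ↦ Z ω ^ 2 + Z' ω ^ 2) μ := j1.add j2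
    rw [← integral_add j1 j2, ← integral_const_mul, ← integral_add j4 (j3.const_mul _)]
    congr 1
    ext ω
    linear_combination (Z' ω) ^ 2 * hs
  have hs1 := hsq 1 (by norm_num)
  have hs2 := hsq (-1) (by norm_num)
  simp only [one_mul] at hs1
  rw [hs1] at e1
  rw [hs2] at e2
  have i5 : Integrable (fun ω ↦ (Z ω + Z' ω) ^ 4 + (Z ω + -1 * Z' ω) ^ 4) μ := i1.add i2
  have i6 : Integrable (fun ω ↦ Z ω ^ 4 + Z' ω ^ 4) μ := i3.add i4
  rw [hpol]
  refine ⟨(i5.sub (i6.const_mul 2)).const_mul _, ?_⟩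
  rw [integral_const_mul, integral_sub i5 (i6.const_mul 2), integral_add i1 i2,
    integral_const_mul, integral_add i3 i4, e1, e2, e3, e4]
  ring

end MemClosedSpan

end GaussianSpace

/-! ### Laws on path space -/

/-- Continuous real functions on `S`, with the σ-algebra generated by the evaluations (as a subtype
of the product space `S → ℝ`). -/
abbrev ContPath (S : Type*) [TopologicalSpace S] : Type _ := {f : S → ℝ // Continuous f}

section PathSpace

variable {S : Type*} [TopologicalSpace S]

/-- The canonical process on path space. -/
def pathEval (t : S) (f : ContPath S) : ℝ := f.1 t

@[fun_prop]
lemma measurable_pathEval (t : S) : Measurable (pathEval t) :=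
  (measurable_pi_apply t).comp measurable_subtype_coe

lemma continuous_pathEval (f : ContPath S) : Continuous fun t ↦ pathEval t f := f.2

lemma measurable_contPath {Ω : Type*} [MeasurableSpace Ω] {Y : Ω → ContPath S}
    (h : ∀ t, Measurable fun ω ↦ pathEval t (Y ω)) : Measurable Y :=
  Measurable.subtype_mk (f := fun ω ↦ (Y ω).1) (measurable_pi_iff.2 h)

/-- A law on path space is determined by its finite-dimensional marginals. -/
lemma contPath_measure_ext {μ ν : Measure (ContPath S)} [IsFiniteMeasure μ] [IsFiniteMeasure ν]
    (h : ∀ I : Finset S, μ.map (fun f ↦ I.restrict fun t ↦ pathEval t f) =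
      ν.map (fun f ↦ I.restrict fun t ↦ pathEval t f)) : μ = ν := by
  have hval : Measurable (Subtype.val : ContPath S → S → ℝ) := measurable_subtype_coe
  have h1 : μ.map Subtype.val = ν.map Subtype.val := by
    have h2 : IsProjectiveLimit (μ.map (Subtype.val : ContPath S → S → ℝ))
        (fun I ↦ μ.map (fun f ↦ I.restrict fun t ↦ pathEval t f)) := fun I ↦ by
      rw [Measure.map_map (Finset.measurable_restrict I) hval]
      rfl
    have h3 : IsProjectiveLimit (ν.map (Subtype.val : ContPath S → S → ℝ))
        (fun I ↦ μ.map (fun f ↦ I.restrict fun t ↦ pathEval t f)) := fun I ↦ by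
      rw [Measure.map_map (Finset.measurable_restrict I) hval]
      exact (h I).symm
    exact h2.unique h3
  ext s hs
  obtain ⟨t, ht, rfl⟩ := hs
  rw [← Measure.map_apply hval ht, ← Measure.map_apply hval ht, h1]

/-- A process with almost surely continuous paths is almost surely equal, at all times
simultaneously, to a random element of path space. -/
lemma exists_measurable_contPath [FirstCountableTopology S] [TopologicalSpace.SeparableSpace S]
    {Ω : Type*} [MeasurableSpace Ω] {P : Measure Ω} {G : S → Ω → ℝ}
    (hG : ∀ t, AEMeasurable (G t) P) (hc : ∀ᵐ ω ∂P, Continuous fun t ↦ G t ω) :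
    ∃ Y : Ω → ContPath S, Measurable Y ∧ ∀ᵐ ω ∂P, ∀ t, pathEval t (Y ω) = G t ω := by
  classical
  obtain ⟨D, hDc, hDd⟩ := TopologicalSpace.exists_countable_dense S
  have hae : ∀ᵐ ω ∂P, (∀ t ∈ D, G t ω = (hG t).mk (G t) ω) ∧ Continuous fun t ↦ G t ω :=
    ((ae_ball_iff hDc).2 fun t _ ↦ (hG t).ae_eq_mk).and hc
  obtain ⟨N, hNsub, hNm, hN0⟩ := exists_measurable_superset_of_null (ae_iff.1 hae)
  have hgood (ω : Ω) (hω : ω ∉ N) :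
      (∀ t ∈ D, G t ω = (hG t).mk (G t) ω) ∧ Continuous fun t ↦ G t ω := by
    by_contra h
    exact hω (hNsub h)
  refine ⟨fun ω ↦ if h : ω ∈ N then ⟨fun _ ↦ 0, continuous_const⟩
    else ⟨fun t ↦ G t ω, (hgood ω h).2⟩, measurable_contPath fun t ↦ ?_, ?_⟩
  · obtain ⟨u, huD, hu⟩ := mem_closure_iff_seq_limit.1 (hDd t)
    refine measurable_of_tendsto_metrizable
      (f := fun n ω ↦ Nᶜ.indicator ((hG (u n)).mk (G (u n))) ω)
      (fun n ↦ (hG (u n)).measurable_mk.indicator hNm.compl) ?_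
    refine tendsto_pi_nhds.2 fun ω ↦ ?_
    by_cases hω : ω ∈ N
    · simp [hω, pathEval]
    · have h1 := ((hgood ω hω).2.tendsto t).comp hu
      simp only [hω, pathEval, dif_neg, not_false_eq_true, mem_compl_iff, indicator_of_mem]
      exact h1.congr fun n ↦ (hgood ω hω).1 (u n) (huD n)
  · filter_upwards [measure_eq_zero_iff_ae_notMem.1 hN0] with ω hω t
    simp [hω, pathEval]

/-- The shift `f ↦ f (h + ·) - f h` of path space, which records the increments after time `h`. -/
def pathShift (h : ℝ) (f : ContPath ℝ) : ContPath ℝ :=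
  ⟨fun t ↦ f.1 (h + t) - f.1 h,
    (f.2.comp (continuous_const.add continuous_id)).sub continuous_const⟩

lemma pathEval_pathShift (h t : ℝ) (f : ContPath ℝ) :
    pathEval t (pathShift h f) = pathEval (h + t) f - pathEval h f := rfl

lemma measurable_pathShift (h : ℝ) : Measurable (pathShift h) :=
  measurable_contPath fun t ↦ by
    simp_rw [pathEval_pathShift]
    exact (measurable_pathEval _).sub (measurable_pathEval _)

lemma pathShift_pathShift (h k : ℝ) (f : ContPath ℝ) :
    pathShift h (pathShift k f) = pathShift (k + h) f := by
  apply Subtype.ext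
  ext t
  simp [pathShift, add_assoc]

lemma iterate_pathShift_one (n : ℕ) (f : ContPath ℝ) (hf : pathEval 0 f = 0) :
    (pathShift 1)^[n] f = pathShift n f := by
  induction n with
  | zero =>
    apply Subtype.ext
    ext t
    have : f.1 0 = 0 := hf
    simp [pathShift, this]
  | succ n ih => rw [Function.iterate_succ_apply', ih, pathShift_pathShift]; simp

/-- The law on path space of a noise is again the law of a noise. -/
lemma IsGaussianNoise.map_contPath {Ω : Type*} [AddMonoid S] [MeasurableSpace Ω] {P : Measure Ω}
    {G : S → Ω → ℝ} (hG : IsGaussianNoise G P) {Y : Ω → ContPath S} (hY : Measurable Y)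
    (hYG : ∀ᵐ ω ∂P, ∀ t, pathEval t (Y ω) = G t ω) :
    IsGaussianNoise (pathEval (S := S)) (P.map Y) where
  gaussian := by
    refine ⟨fun I ↦ ⟨?_⟩⟩
    rw [Measure.map_map (by fun_prop) hY]
    have h := (hG.gaussian.hasGaussianLaw I).isGaussian_map
    rwa [Measure.map_congr (g := (fun f ↦ I.restrict fun t ↦ pathEval t f) ∘ Y)] at h
    filter_upwards [hYG] with ω hω
    ext t
    exact (hω t).symm
  centered t := by
    rw [integral_map hY.aemeasurable (by fun_prop), ← hG.centered t]
    exact integral_congr_ae (by filter_upwards [hYG] with ω hω using hω t)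
  start_zero := by
    refine (ae_map_iff hY.aemeasurable
      (measurableSet_eq_fun (measurable_pathEval 0) measurable_const)).2 ?_
    filter_upwards [hYG, hG.start_zero] with ω h1 h2
    rw [h1, h2]
  stationary h I := by
    have hm (g : S → ContPath S → ℝ) (hg : ∀ t, Measurable (g t)) :
        Measurable fun f ↦ I.restrict fun t ↦ g t f := measurable_pi_iff.2 fun t ↦ hg t
    have hm1 := hm (fun t f ↦ pathEval (h + t) f - pathEval h f) fun t ↦ by fun_prop
    have hm2 := hm (fun t f ↦ pathEval t f - pathEval 0 f) fun t ↦ by fun_prop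
    refine ⟨hm1.aemeasurable, hm2.aemeasurable, ?_⟩
    rw [Measure.map_map hm1 hY, Measure.map_map hm2 hY]
    have h1 := (hG.stationary h I).map_eq
    rwa [Measure.map_congr
        (g := (fun f ↦ I.restrict fun t ↦ pathEval (h + t) f - pathEval h f) ∘ Y),
      Measure.map_congr (f := fun ω ↦ I.restrict fun t ↦ G t ω - G 0 ω)
        (g := (fun f ↦ I.restrict fun t ↦ pathEval t f - pathEval 0 f) ∘ Y)] at h1
    all_goals
      filter_upwards [hYG] with ω hω
      ext t
      simp [hω]
  continuous := ae_of_all _ continuous_pathEval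

/-- The law of a noise on the line is invariant under all shifts. -/
lemma IsGaussianNoise.measurePreserving_pathShift {μ : Measure (ContPath ℝ)} [IsFiniteMeasure μ]
    (hμ : IsGaussianNoise (pathEval (S := ℝ)) μ) (h : ℝ) :
    MeasurePreserving (pathShift h) μ μ := by
  refine ⟨measurable_pathShift h, contPath_measure_ext fun I ↦ ?_⟩
  rw [Measure.map_map (by fun_prop) (measurable_pathShift h)]
  have h1 := (hμ.stationary h I).map_eq
  rw [Measure.map_congr (f := fun f ↦ I.restrict fun t ↦ pathEval t f - pathEval 0 f)
        (g := fun f ↦ I.restrict fun t ↦ pathEval t f)] at h1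
  · exact h1
  · filter_upwards [hμ.start_zero] with f hf
    ext t
    simp [hf]

/-- Restriction of a path on the line to the nonnegative half-line. -/
def pathRestrict (f : ContPath ℝ) : ContPath ℝ≥0 := ⟨fun t ↦ f.1 t, f.2.comp NNReal.continuous_coe⟩

lemma pathEval_pathRestrict (t : ℝ≥0) (f : ContPath ℝ) :
    pathEval t (pathRestrict f) = pathEval (t : ℝ) f := rfl

lemma measurable_pathRestrict : Measurable pathRestrict :=
  measurable_contPath fun t ↦ measurable_pathEval (t : ℝ)

end PathSpace

/-! ### Mixtures of square integrable random variables and the exponential law -/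

section MixedMoments

variable {Ω A : Type*} [MeasurableSpace Ω] [MeasurableSpace A] {μ : Measure Ω} {κ : Measure A}
  [IsFiniteMeasure μ] [IsFiniteMeasure κ] {Z : A → Ω → ℝ} {Y : Ω → ℝ}

/-- A jointly measurable random field `Z` over a finite measure space `(A, κ)` whose second moments
are `κ`-integrable. -/
structure IsSquareIntegrableField (Z : A → Ω → ℝ) (μ : Measure Ω) (κ : Measure A) : Prop where
  measurable : Measurable (Function.uncurry Z)
  memLp : ∀ a, MemLp (Z a) 2 μ
  integrable : Integrable (fun a ↦ ∫ ω, Z a ω ^ 2 ∂μ) κ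

lemma sq_integral_le_of_integrable {g : A → ℝ} (h1 : Integrable g κ)
    (h2 : Integrable (fun a ↦ g a ^ 2) κ) :
    (∫ a, g a ∂κ) ^ 2 ≤ κ.real univ * ∫ a, g a ^ 2 ∂κ := by
  set M := κ.real univ
  set I := ∫ a, g a ∂κ
  have h3 : 0 ≤ ∫ a, (M * g a - I) ^ 2 ∂κ := integral_nonneg fun a ↦ sq_nonneg _
  have i1 : Integrable (fun a ↦ M ^ 2 * g a ^ 2) κ := h2.const_mul _
  have i2 : Integrable (fun a ↦ 2 * M * I * g a) κ := h1.const_mul _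
  have h4 : ∫ a, (M * g a - I) ^ 2 ∂κ =
      M ^ 2 * ∫ a, g a ^ 2 ∂κ - 2 * M * I * I + I ^ 2 * M := by
    have h5 : ∀ a, (M * g a - I) ^ 2 = (M ^ 2 * g a ^ 2 - 2 * M * I * g a) + I ^ 2 := fun a ↦ by
      ring
    have i3 : Integrable (fun a ↦ M ^ 2 * g a ^ 2 - 2 * M * I * g a) κ := i1.sub i2
    simp_rw [h5]
    rw [integral_add i3 (integrable_const _), integral_sub i1 i2, integral_const_mul,
      integral_const_mul]
    simp [M, I, mul_comm]
  rcases (measureReal_nonneg : 0 ≤ M).eq_or_lt with hM | hM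
  · have hκ : κ = 0 := by
      have h6 : κ.real univ = 0 := hM.symm
      rwa [measureReal_eq_zero_iff, Measure.measure_univ_eq_zero] at h6
    simp [I, hκ]
  · have h7 : 0 ≤ M * (M * ∫ a, g a ^ 2 ∂κ - I ^ 2) := by
      rw [h4] at h3
      linarith
    linarith [nonneg_of_mul_nonneg_right h7 hM]

namespace IsSquareIntegrableField

lemma integrable_sq_prod (hZ : IsSquareIntegrableField Z μ κ) :
    Integrable (fun p : Ω × A ↦ Z p.2 p.1 ^ 2) (μ.prod κ) := by
  have hm : Measurable fun p : Ω × A ↦ Z p.2 p.1 ^ 2 :=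
    (hZ.measurable.comp measurable_swap).pow_const 2
  rw [integrable_prod_iff' hm.aestronglyMeasurable]
  refine ⟨ae_of_all _ fun a ↦ (hZ.memLp a).integrable_sq, ?_⟩
  simpa using hZ.integrable

lemma integrable_mul_prod (hZ : IsSquareIntegrableField Z μ κ) (hY : MemLp Y 2 μ) :
    Integrable (fun p : Ω × A ↦ Y p.1 * Z p.2 p.1) (μ.prod κ) := by
  have h1 : Integrable (fun p : Ω × A ↦ Y p.1 ^ 2) (μ.prod κ) := hY.integrable_sq.comp_fst κ
  refine (h1.add hZ.integrable_sq_prod).mono'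
    (hY.1.comp_fst.mul (hZ.measurable.comp measurable_swap).aestronglyMeasurable)
    (ae_of_all _ fun p ↦ ?_)
  rw [Real.norm_eq_abs, abs_le, Pi.add_apply]
  constructor <;> nlinarith [sq_nonneg (Y p.1 - Z p.2 p.1), sq_nonneg (Y p.1 + Z p.2 p.1),
    sq_nonneg (Y p.1), sq_nonneg (Z p.2 p.1)]

lemma ae_integrable (hZ : IsSquareIntegrableField Z μ κ) :
    ∀ᵐ ω ∂μ, Integrable (fun a ↦ Z a ω) κ := by
  have h := hZ.integrable_mul_prod (memLp_const 1)
  simp only [one_mul] at h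
  exact h.prod_right_ae

lemma ae_integrable_sq (hZ : IsSquareIntegrableField Z μ κ) :
    ∀ᵐ ω ∂μ, Integrable (fun a ↦ Z a ω ^ 2) κ :=
  hZ.integrable_sq_prod.prod_right_ae

omit [IsFiniteMeasure μ] in
lemma measurable_integral (hZ : IsSquareIntegrableField Z μ κ) :
    Measurable fun ω ↦ ∫ a, Z a ω ∂κ :=
  ((hZ.measurable.comp measurable_swap).stronglyMeasurable.integral_prod_right
    (f := fun ω a ↦ Z a ω)).measurable

lemma memLp_integral (hZ : IsSquareIntegrableField Z μ κ) :
    MemLp (fun ω ↦ ∫ a, Z a ω ∂κ) 2 μ := by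
  have hm := hZ.measurable_integral.aestronglyMeasurable (μ := μ)
  refine (memLp_two_iff_integrable_sq hm).2 ?_
  refine (hZ.integrable_sq_prod.integral_prod_left.const_mul (κ.real univ)).mono'
    (hm.pow 2) ?_
  filter_upwards [hZ.ae_integrable, hZ.ae_integrable_sq] with ω h1 h2
  rw [Real.norm_eq_abs, abs_of_nonneg (sq_nonneg _)]
  exact sq_integral_le_of_integrable h1 h2

lemma integral_mul_integral (hZ : IsSquareIntegrableField Z μ κ) (hY : MemLp Y 2 μ) :
    ∫ ω, Y ω * ∫ a, Z a ω ∂κ ∂μ = ∫ a, ∫ ω, Y ω * Z a ω ∂μ ∂κ := by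
  simp_rw [← integral_const_mul]
  exact integral_integral_swap (hZ.integrable_mul_prod hY)

lemma integral_sq_integral (hZ : IsSquareIntegrableField Z μ κ) :
    ∫ ω, (∫ a, Z a ω ∂κ) ^ 2 ∂μ = ∫ a, ∫ b, ∫ ω, Z a ω * Z b ω ∂μ ∂κ ∂κ := by
  simp_rw [sq]
  rw [hZ.integral_mul_integral hZ.memLp_integral]
  refine integral_congr_ae (ae_of_all _ fun a ↦ ?_)
  simp_rw [← hZ.integral_mul_integral (hZ.memLp a), mul_comm]

end IsSquareIntegrableField

end MixedMoments

section ExponentialLaw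

variable {θ : ℝ}

/-- The exponential law with density `θ e^{-θ a}` on `(0, ∞)`. -/
noncomputable def expLaw (θ : ℝ) : Measure ℝ :=
  (volume.restrict (Ioi 0)).withDensity fun a ↦ ENNReal.ofReal (θ * Real.exp (-θ * a))

lemma integral_expLaw (hθ : 0 < θ) (g : ℝ → ℝ) :
    ∫ a, g a ∂(expLaw θ) = ∫ a in Ioi (0 : ℝ), θ * Real.exp (-θ * a) * g a := by
  rw [expLaw, integral_withDensity_eq_integral_toReal_smul (by fun_prop) (by simp)]
  refine integral_congr_ae (ae_of_all _ fun a ↦ ?_)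
  simp only [smul_eq_mul]
  rw [ENNReal.toReal_ofReal (by positivity)]

lemma integrable_expLaw_iff (hθ : 0 < θ) (g : ℝ → ℝ) :
    Integrable g (expLaw θ) ↔ IntegrableOn (fun a ↦ θ * Real.exp (-θ * a) * g a) (Ioi 0) := by
  rw [expLaw, integrable_withDensity_iff (by fun_prop) (by simp), IntegrableOn]
  refine integrable_congr (ae_of_all _ fun a ↦ ?_)
  simp only
  rw [ENNReal.toReal_ofReal (by positivity), mul_comm]

lemma lintegral_expLaw (g : ℝ → ENNReal) (hg : Measurable g) :
    ∫⁻ a, g a ∂(expLaw θ) =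
      ∫⁻ a in Ioi (0 : ℝ), ENNReal.ofReal (θ * Real.exp (-θ * a)) * g a := by
  rw [expLaw, lintegral_withDensity_eq_lintegral_mul _ (by fun_prop) hg]
  rfl

lemma lintegral_Ioi_exp_neg_mul {b : ℝ} (hb : 0 < b) :
    ∫⁻ a in Ioi (0 : ℝ), ENNReal.ofReal (Real.exp (-b * a)) = ENNReal.ofReal (1 / b) := by
  rw [← ofReal_integral_eq_lintegral_ofReal (integrableOn_exp_mul_Ioi (by linarith) 0)
    (ae_of_all _ fun a ↦ (Real.exp_pos _).le), integral_exp_mul_Ioi (by linarith)]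
  congr 1
  simp

lemma isProbabilityMeasure_expLaw (hθ : 0 < θ) : IsProbabilityMeasure (expLaw θ) := by
  refine ⟨?_⟩
  rw [← lintegral_one, lintegral_expLaw _ measurable_const]
  simp_rw [mul_one, ENNReal.ofReal_mul hθ.le]
  rw [lintegral_const_mul _ (by fun_prop), lintegral_Ioi_exp_neg_mul hθ,
    ← ENNReal.ofReal_mul hθ.le, mul_one_div_cancel hθ.ne', ENNReal.ofReal_one]

lemma integrable_expLaw_abs_add_one_sq (hθ : 0 < θ) :
    Integrable (fun a ↦ (|a| + 1) ^ 2) (expLaw θ) := by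
  rw [integrable_expLaw_iff hθ]
  refine integrable_of_isBigO_exp_neg (b := θ / 2) (by positivity) (by fun_prop) ?_
  have h1 : (fun a : ℝ ↦ (|a| + 1) ^ 2) =O[atTop] fun a ↦ Real.exp (θ / 2 * a) := by
    have h2 : (fun a : ℝ ↦ (|a| + 1) ^ 2) =O[atTop] fun a ↦ a ^ 2 := by
      refine Asymptotics.IsBigO.of_bound 4 ?_
      filter_upwards [eventually_ge_atTop 1] with a ha
      rw [Real.norm_eq_abs, Real.norm_eq_abs, abs_of_nonneg (by positivity),
        abs_of_nonneg (sq_nonneg a), abs_of_nonneg (by linarith)]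
      nlinarith
    exact h2.trans (isLittleO_pow_exp_pos_mul_atTop 2 (by positivity)).isBigO
  have h3 : (fun a : ℝ ↦ θ * Real.exp (-θ * a)) =O[atTop] fun a ↦ Real.exp (-θ * a) :=
    (Asymptotics.isBigO_refl _ _).const_mul_left θ
  refine (h3.mul h1).congr_right fun a ↦ ?_
  rw [← Real.exp_add]
  congr 1
  ring

instance : SFinite (expLaw θ) := by
  unfold expLaw
  infer_instance

/-- By lack of memory, the part of the law of `a - b` carried by `(0, ∞)`, for independent
exponential `a` and `b`, is half of the exponential law. -/
lemma lintegral_lintegral_expLaw_indicator (hθ : 0 < θ) (g : ℝ → ENNReal) (hg : Measurable g) :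
    ∫⁻ b, ∫⁻ a, (Ioi 0).indicator g (a - b) ∂(expLaw θ) ∂(expLaw θ) =
      ENNReal.ofReal (1 / 2) * ∫⁻ a, g a ∂(expLaw θ) := by
  have h1 (b : ℝ) (hb : b ∈ Ioi (0 : ℝ)) : ∫⁻ a, (Ioi 0).indicator g (a - b) ∂(expLaw θ) =
      ENNReal.ofReal (Real.exp (-θ * b)) * ∫⁻ a, g a ∂(expLaw θ) := by
    have hb' : (0 : ℝ) < b := hb
    have hgi : Measurable fun a ↦ (Ioi 0).indicator g (a - b) :=
      (hg.indicator measurableSet_Ioi).comp (measurable_id.sub_const b)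
    rw [lintegral_expLaw _ hgi, lintegral_expLaw _ hg, ← lintegral_const_mul _ (by fun_prop),
      ← lintegral_indicator measurableSet_Ioi, ← lintegral_indicator measurableSet_Ioi]
    conv_rhs => rw [← lintegral_sub_right_eq_self _ b]
    refine lintegral_congr fun a ↦ ?_
    by_cases ha : 0 < a - b
    · have ha' : 0 < a := by linarith
      simp only [indicator, mem_Ioi, ha, ha', if_true]
      rw [← mul_assoc, ← ENNReal.ofReal_mul (Real.exp_pos _).le]
      congr 2
      rw [mul_left_comm, ← Real.exp_add]
      congr 2
      ring
    · simp [indicator, ha]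
  have h2 : ∫⁻ b, ∫⁻ a, (Ioi 0).indicator g (a - b) ∂(expLaw θ) ∂(expLaw θ) =
      ∫⁻ b, ENNReal.ofReal (Real.exp (-θ * b)) * ∫⁻ a, g a ∂(expLaw θ) ∂(expLaw θ) := by
    refine lintegral_congr_ae ?_
    have h3 : ∀ᵐ b ∂(expLaw θ), b ∈ Ioi (0 : ℝ) :=
      (withDensity_absolutelyContinuous _ _).ae_le (ae_restrict_mem measurableSet_Ioi)
    filter_upwards [h3] with b hb using h1 b hb
  rw [h2, lintegral_mul_const _ (by fun_prop), lintegral_expLaw _ (by fun_prop)]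
  congr 1
  have h4 (a : ℝ) : ENNReal.ofReal (θ * Real.exp (-θ * a)) * ENNReal.ofReal (Real.exp (-θ * a)) =
      ENNReal.ofReal θ * ENNReal.ofReal (Real.exp (-(2 * θ) * a)) := by
    rw [← ENNReal.ofReal_mul (by positivity), ← ENNReal.ofReal_mul hθ.le, mul_assoc,
      ← Real.exp_add]
    congr 3
    ring
  simp_rw [h4]
  rw [lintegral_const_mul _ (by fun_prop), lintegral_Ioi_exp_neg_mul (by positivity),
    ← ENNReal.ofReal_mul hθ.le]
  congr 1
  field_simp

/-- If `a` and `b` are independent exponential variables, then `|a - b|` is exponential with the same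
parameter. The hypothesis `g 0 = 0` takes care of the null event `a = b`. -/
lemma lintegral_lintegral_expLaw_sub (hθ : 0 < θ) (g : ℝ → ENNReal) (hg : Measurable g)
    (hg0 : g 0 = 0) (hge : ∀ a, g (-a) = g a) :
    ∫⁻ a, ∫⁻ b, g (a - b) ∂(expLaw θ) ∂(expLaw θ) = ∫⁻ a, g a ∂(expLaw θ) := by
  have hgi : Measurable ((Ioi 0).indicator g) := hg.indicator measurableSet_Ioi
  have h1 (a b : ℝ) : g (a - b) =
      (Ioi 0).indicator g (a - b) + (Ioi 0).indicator g (b - a) := by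
    rcases lt_trichotomy a b with h | h | h
    · have h2 : ¬ b < a := h.not_gt
      simp [indicator, h, h2, ← hge (a - b)]
    · simp [h, hg0]
    · have h2 : ¬ a < b := h.not_gt
      simp [indicator, h, h2]
  have m1 : Measurable fun p : ℝ × ℝ ↦ (Ioi 0).indicator g (p.1 - p.2) :=
    hgi.comp (measurable_fst.sub measurable_snd)
  simp_rw [h1]
  have h3 (a : ℝ) : ∫⁻ b, ((Ioi 0).indicator g (a - b) + (Ioi 0).indicator g (b - a)) ∂(expLaw θ) =
      ∫⁻ b, (Ioi 0).indicator g (a - b) ∂(expLaw θ) +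
        ∫⁻ b, (Ioi 0).indicator g (b - a) ∂(expLaw θ) :=
    lintegral_add_left (hgi.comp (measurable_const.sub measurable_id)) _
  simp_rw [h3]
  rw [lintegral_add_left m1.lintegral_prod_right', lintegral_lintegral_expLaw_indicator hθ g hg,
    lintegral_lintegral_swap m1.aemeasurable, lintegral_lintegral_expLaw_indicator hθ g hg,
    ← add_mul, ← ENNReal.ofReal_add (by norm_num) (by norm_num)]
  norm_num

end ExponentialLaw

/-! ### Second moments of the stationary solution -/

/-- The second moment `E[f(t)²]` of the canonical process under the law `μ`. -/
noncomputable def pathVariance (μ : Measure (ContPath ℝ)) (t : ℝ) : ℝ := ∫ f, pathEval t f ^ 2 ∂μ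

/-- The stationary Ornstein–Uhlenbeck functional, written as `∫ (f t - f (t - a)) θ e^{-θ a} da`.
In this form it commutes with the shifts of path space without any integrability assumption. -/
noncomputable def stationaryPath (θ t : ℝ) (f : ContPath ℝ) : ℝ :=
  ∫ a, (pathEval t f - pathEval (t - a) f) ∂(expLaw θ)

/-- The autocovariance of the stationary Ornstein–Uhlenbeck functional. -/
noncomputable def pathAutocov (θ : ℝ) (μ : Measure (ContPath ℝ)) (t : ℝ) : ℝ :=
  ∫ f, stationaryPath θ t f * stationaryPath θ 0 f ∂μ

section CanonicalProcess

lemma measurable_uncurry_pathEval : Measurable (Function.uncurry (pathEval (S := ℝ))) :=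
  measurable_uncurry_of_continuous_of_measurable continuous_pathEval measurable_pathEval

lemma measurable_uncurry_stationaryPath (θ : ℝ) :
    Measurable (Function.uncurry (stationaryPath θ)) := by
  have h1 : Measurable fun p : (ℝ × ContPath ℝ) × ℝ ↦
      pathEval p.1.1 p.1.2 - pathEval (p.1.1 - p.2) p.1.2 := by
    refine Measurable.sub ?_ ?_
    · exact measurable_uncurry_pathEval.comp measurable_fst
    · exact measurable_uncurry_pathEval.comp
        (((measurable_fst.comp measurable_fst).sub measurable_snd).prodMk
          (measurable_snd.comp measurable_fst))
  exact h1.stronglyMeasurable.integral_prod_right'.measurable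

lemma measurable_stationaryPath (θ t : ℝ) : Measurable (stationaryPath θ t) :=
  (measurable_uncurry_stationaryPath θ).comp (measurable_const.prodMk measurable_id)

lemma stationaryPath_pathShift (θ h t : ℝ) (f : ContPath ℝ) :
    stationaryPath θ t (pathShift h f) = stationaryPath θ (h + t) f := by
  simp only [stationaryPath, pathEval_pathShift, sub_sub_sub_cancel_right, add_sub_assoc]

variable {μ : Measure (ContPath ℝ)} [IsProbabilityMeasure μ] {θ : ℝ}

omit [IsProbabilityMeasure μ] in
lemma memLp_pathEval (hμ : IsGaussianNoise (pathEval (S := ℝ)) μ) (t : ℝ) :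
    MemLp (pathEval t) 2 μ := (hμ.gaussian.hasGaussianLaw_eval t).memLp_two

lemma integral_sq_increment (hμ : IsGaussianNoise (pathEval (S := ℝ)) μ) (s t : ℝ) :
    ∫ f, (pathEval t f - pathEval s f) ^ 2 ∂μ = pathVariance μ (t - s) := by
  have h1 := (hμ.measurePreserving_pathShift s).map_eq
  have h2 : Measurable fun f : ContPath ℝ ↦ pathEval (t - s) f ^ 2 := by fun_prop
  rw [pathVariance]
  conv_rhs => rw [← h1]
  rw [integral_map (measurable_pathShift s).aemeasurable h2.aestronglyMeasurable]
  simp [pathEval_pathShift]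

lemma pathVariance_zero (hμ : IsGaussianNoise (pathEval (S := ℝ)) μ) : pathVariance μ 0 = 0 := by
  have h := integral_sq_increment hμ 0 0
  simpa using h.symm

lemma pathVariance_neg (hμ : IsGaussianNoise (pathEval (S := ℝ)) μ) (t : ℝ) :
    pathVariance μ (-t) = pathVariance μ t := by
  have h1 := integral_sq_increment hμ 0 t
  have h2 := integral_sq_increment hμ t 0
  rw [sub_zero] at h1
  rw [zero_sub] at h2
  rw [← h1, ← h2]
  congr 1
  ext f
  ring

omit [IsProbabilityMeasure μ] in
lemma pathVariance_nonneg (t : ℝ) : 0 ≤ pathVariance μ t := integral_nonneg fun _ ↦ sq_nonneg _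

lemma measurable_pathVariance : Measurable (pathVariance μ) := by
  have h : Measurable fun p : ℝ × ContPath ℝ ↦ pathEval p.1 p.2 ^ 2 :=
    measurable_uncurry_pathEval.pow_const 2
  exact h.stronglyMeasurable.integral_prod_right'.measurable

/-- `E[f(n)²] ≤ n² E[f(1)²]`, by the Cauchy–Schwarz inequality for the `n` unit increments. -/
lemma pathVariance_natCast_le (hμ : IsGaussianNoise (pathEval (S := ℝ)) μ) (n : ℕ) :
    pathVariance μ n ≤ n ^ 2 * pathVariance μ 1 := by
  have h1 (k : ℕ) : MemLp (fun f ↦ pathEval (k + 1 : ℝ) f - pathEval (k : ℝ) f) 2 μ :=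
    (memLp_pathEval hμ _).sub (memLp_pathEval hμ _)
  have h2 : ∀ᵐ f ∂μ, pathEval (n : ℝ) f ^ 2 ≤
      n * ∑ k ∈ Finset.range n, (pathEval (k + 1 : ℝ) f - pathEval (k : ℝ) f) ^ 2 := by
    filter_upwards [hμ.start_zero] with f hf
    have h3 := Finset.sum_range_sub (fun k : ℕ ↦ pathEval (k : ℝ) f) n
    simp only [Nat.cast_add, Nat.cast_one, Nat.cast_zero, hf, sub_zero] at h3
    have h4 := sq_sum_le_card_mul_sum_sq (s := Finset.range n)
      (f := fun k : ℕ ↦ pathEval (k + 1 : ℝ) f - pathEval (k : ℝ) f)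
    rwa [h3, Finset.card_range] at h4
  have h5 : Integrable (fun f ↦
      n * ∑ k ∈ Finset.range n, (pathEval (k + 1 : ℝ) f - pathEval (k : ℝ) f) ^ 2) μ :=
    (integrable_finsetSum _ fun k _ ↦ (h1 k).integrable_sq).const_mul _
  refine (integral_mono_ae (memLp_pathEval hμ n).integrable_sq h5 h2).trans_eq ?_
  rw [integral_const_mul, integral_finsetSum _ fun k _ ↦ (h1 k).integrable_sq]
  simp_rw [integral_sq_increment hμ]
  simp
  ring

lemma integrable_pathVariance (hμ : IsGaussianNoise (pathEval (S := ℝ)) μ) (hθ : 0 < θ)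
    (hmono : MonotoneOn (pathVariance μ) (Ici 0)) : Integrable (pathVariance μ) (expLaw θ) := by
  refine ((integrable_expLaw_abs_add_one_sq hθ).mul_const (pathVariance μ 1)).mono'
    measurable_pathVariance.aestronglyMeasurable (ae_of_all _ fun t ↦ ?_)
  have h1 : pathVariance μ t = pathVariance μ |t| := by
    rcases abs_cases t with h | h <;> rw [h.1]
    rw [pathVariance_neg hμ]
  rw [Real.norm_eq_abs, abs_of_nonneg (pathVariance_nonneg t), h1]
  have h2 : pathVariance μ |t| ≤ pathVariance μ (⌈|t|⌉₊ : ℝ) :=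
    hmono (abs_nonneg t) (mem_Ici.2 (Nat.cast_nonneg _)) (Nat.le_ceil _)
  refine h2.trans ((pathVariance_natCast_le hμ _).trans ?_)
  have h3 : (⌈|t|⌉₊ : ℝ) ≤ |t| + 1 := (Nat.ceil_lt_add_one (abs_nonneg t)).le
  have h4 : (0 : ℝ) ≤ (⌈|t|⌉₊ : ℝ) := Nat.cast_nonneg _
  exact mul_le_mul_of_nonneg_right (pow_le_pow_left₀ h4 h3 2) (pathVariance_nonneg 1)

lemma isSquareIntegrableField_increments (hμ : IsGaussianNoise (pathEval (S := ℝ)) μ)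
    (hV : Integrable (pathVariance μ) (expLaw θ)) (t : ℝ) :
    IsSquareIntegrableField (fun a f ↦ pathEval t f - pathEval (t - a) f) μ (expLaw θ) where
  measurable := by
    refine Measurable.sub ?_ ?_
    · exact (measurable_pathEval t).comp measurable_snd
    · exact measurable_uncurry_pathEval.comp
        ((measurable_const.sub measurable_fst).prodMk measurable_snd)
  memLp a := (memLp_pathEval hμ _).sub (memLp_pathEval hμ _)
  integrable := by
    simp_rw [integral_sq_increment hμ, sub_sub_cancel]
    exact hV

/-- The stationary solution lives in the closed Gaussian space spanned by the noise. -/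
lemma memClosedSpan_stationaryPath (hμ : IsGaussianNoise (pathEval (S := ℝ)) μ) (hθ : 0 < θ)
    (hV : Integrable (pathVariance μ) (expLaw θ)) (t : ℝ) :
    MemClosedSpan pathEval μ (stationaryPath θ t) := by
  have := isProbabilityMeasure_expLaw hθ
  have hD := isSquareIntegrableField_increments hμ hV t
  refine ⟨hD.memLp_integral, fun Y hY h ↦ ?_⟩
  have h1 := hD.integral_mul_integral hY
  refine h1.trans (integral_eq_zero_of_ae (ae_of_all _ fun a ↦ ?_))
  have h2 : Integrable (fun f ↦ Y f * pathEval t f) μ := hY.integrable_mul (memLp_pathEval hμ t)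
  have h3 : Integrable (fun f ↦ Y f * pathEval (t - a) f) μ :=
    hY.integrable_mul (memLp_pathEval hμ (t - a))
  simp_rw [mul_sub]
  rw [integral_sub h2 h3, h t, h (t - a), sub_zero]
  rfl

lemma integrable_prod_pathVariance_sub (hμ : IsGaussianNoise (pathEval (S := ℝ)) μ) (hθ : 0 < θ)
    (hV : Integrable (pathVariance μ) (expLaw θ)) :
    Integrable (fun p : ℝ × ℝ ↦ pathVariance μ (p.1 - p.2)) ((expLaw θ).prod (expLaw θ)) ∧
    ∫ p : ℝ × ℝ, pathVariance μ (p.1 - p.2) ∂((expLaw θ).prod (expLaw θ)) =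
      ∫ a, pathVariance μ a ∂(expLaw θ) := by
  have := isProbabilityMeasure_expLaw hθ
  have hm : Measurable fun p : ℝ × ℝ ↦ pathVariance μ (p.1 - p.2) :=
    measurable_pathVariance.comp (measurable_fst.sub measurable_snd)
  have h1 : ∫⁻ p : ℝ × ℝ, ENNReal.ofReal (pathVariance μ (p.1 - p.2))
      ∂((expLaw θ).prod (expLaw θ)) = ∫⁻ a, ENNReal.ofReal (pathVariance μ a) ∂(expLaw θ) := by
    rw [lintegral_prod _ hm.ennreal_ofReal.aemeasurable]
    exact lintegral_lintegral_expLaw_sub hθ _ measurable_pathVariance.ennreal_ofReal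
      (by simp [pathVariance_zero hμ]) (fun a ↦ by rw [pathVariance_neg hμ])
  refine ⟨⟨hm.aestronglyMeasurable, ?_⟩, ?_⟩
  · rw [hasFiniteIntegral_iff_ofReal (ae_of_all _ fun p ↦ pathVariance_nonneg _), h1]
    exact (hasFiniteIntegral_iff_ofReal (ae_of_all _ fun p ↦ pathVariance_nonneg _)).1 hV.2
  · rw [integral_eq_lintegral_of_nonneg_ae (ae_of_all _ fun p ↦ pathVariance_nonneg _)
        hm.aestronglyMeasurable, h1,
      integral_eq_lintegral_of_nonneg_ae (ae_of_all _ fun p ↦ pathVariance_nonneg _) hV.1]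

/-- The stationary variance: for independent exponential `a, b`, the covariance of the increments
over `[t - a, t]` and `[t - b, t]` is `(V a + V b - V (a - b)) / 2`, and `|a - b|` has the same law as
`a`. -/
lemma integral_sq_stationaryPath (hμ : IsGaussianNoise (pathEval (S := ℝ)) μ) (hθ : 0 < θ)
    (hV : Integrable (pathVariance μ) (expLaw θ)) (t : ℝ) :
    ∫ f, stationaryPath θ t f ^ 2 ∂μ = 1 / 2 * ∫ a, pathVariance μ a ∂(expLaw θ) := by
  have := isProbabilityMeasure_expLaw hθ
  have hD := isSquareIntegrableField_increments hμ hV t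
  obtain ⟨h1, h2⟩ := integrable_prod_pathVariance_sub hμ hθ hV
  have h3 : ∫ f, stationaryPath θ t f ^ 2 ∂μ = _ := hD.integral_sq_integral
  have h4 (a b : ℝ) : ∫ f, (pathEval t f - pathEval (t - a) f) *
      (pathEval t f - pathEval (t - b) f) ∂μ =
      1 / 2 * (pathVariance μ a + pathVariance μ b - pathVariance μ (a - b)) := by
    have h5 (f : ContPath ℝ) : (pathEval t f - pathEval (t - a) f) *
        (pathEval t f - pathEval (t - b) f) = 1 / 2 * (((pathEval t f - pathEval (t - a) f) ^ 2 +
        (pathEval t f - pathEval (t - b) f) ^ 2) -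
        (pathEval (t - b) f - pathEval (t - a) f) ^ 2) := by ring
    have i1 := (hD.memLp a).integrable_sq
    have i2 := (hD.memLp b).integrable_sq
    have i3 : Integrable (fun f ↦ (pathEval (t - b) f - pathEval (t - a) f) ^ 2) μ :=
      ((memLp_pathEval hμ (t - b)).sub (memLp_pathEval hμ (t - a))).integrable_sq
    have i4 : Integrable (fun f ↦ (pathEval t f - pathEval (t - a) f) ^ 2 +
        (pathEval t f - pathEval (t - b) f) ^ 2) μ := i1.add i2
    simp_rw [h5]
    rw [integral_const_mul, integral_sub i4 i3, integral_add i1 i2, integral_sq_increment hμ,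
      integral_sq_increment hμ, integral_sq_increment hμ]
    simp
  have i5 : Integrable (fun p : ℝ × ℝ ↦ pathVariance μ p.1) ((expLaw θ).prod (expLaw θ)) :=
    hV.comp_fst _
  have i6 : Integrable (fun p : ℝ × ℝ ↦ pathVariance μ p.2) ((expLaw θ).prod (expLaw θ)) :=
    hV.comp_snd _
  have i7 : Integrable (fun p : ℝ × ℝ ↦ pathVariance μ p.1 + pathVariance μ p.2)
    ((expLaw θ).prod (expLaw θ)) := i5.add i6
  rw [h3]
  simp_rw [h4]
  rw [← integral_prod (fun p : ℝ × ℝ ↦ 1 / 2 * (pathVariance μ p.1 + pathVariance μ p.2 -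
    pathVariance μ (p.1 - p.2))) ((i7.sub h1).const_mul _), integral_const_mul,
    integral_sub i7 h1, integral_add i5 i6, h2, integral_fun_fst, integral_fun_snd]
  simp

lemma memLp_stationaryPath (hμ : IsGaussianNoise (pathEval (S := ℝ)) μ) (hθ : 0 < θ)
    (hV : Integrable (pathVariance μ) (expLaw θ)) (t : ℝ) : MemLp (stationaryPath θ t) 2 μ :=
  (memClosedSpan_stationaryPath hμ hθ hV t).1

lemma integral_stationaryPath_mul (hμ : IsGaussianNoise (pathEval (S := ℝ)) μ) (s t : ℝ) :
    ∫ f, stationaryPath θ t f * stationaryPath θ s f ∂μ = pathAutocov θ μ (t - s) := by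
  have h1 := (hμ.measurePreserving_pathShift s).map_eq
  have h2 : Measurable fun f ↦ stationaryPath θ (t - s) f * stationaryPath θ 0 f :=
    (measurable_stationaryPath _ _).mul (measurable_stationaryPath _ _)
  rw [pathAutocov]
  conv_rhs => rw [← h1]
  rw [integral_map (measurable_pathShift s).aemeasurable h2.aestronglyMeasurable]
  simp [stationaryPath_pathShift]

lemma pathAutocov_neg (hμ : IsGaussianNoise (pathEval (S := ℝ)) μ) (t : ℝ) :
    pathAutocov θ μ (-t) = pathAutocov θ μ t := by
  have h1 := integral_stationaryPath_mul (θ := θ) hμ 0 t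
  have h2 := integral_stationaryPath_mul (θ := θ) hμ t 0
  rw [sub_zero] at h1
  rw [zero_sub] at h2
  rw [← h1, ← h2]
  simp_rw [mul_comm]

lemma measurable_pathAutocov : Measurable (pathAutocov θ μ) := by
  have h : Measurable fun p : ℝ × ContPath ℝ ↦ stationaryPath θ p.1 p.2 * stationaryPath θ 0 p.2 :=
    (measurable_uncurry_stationaryPath θ).mul ((measurable_stationaryPath θ 0).comp measurable_snd)
  exact h.stronglyMeasurable.integral_prod_right'.measurable

lemma abs_pathAutocov_le (hμ : IsGaussianNoise (pathEval (S := ℝ)) μ) (hθ : 0 < θ)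
    (hV : Integrable (pathVariance μ) (expLaw θ)) (t : ℝ) :
    |pathAutocov θ μ t| ≤ 1 / 2 * ∫ a, pathVariance μ a ∂(expLaw θ) := by
  have h1 := memLp_stationaryPath hμ hθ hV t
  have h2 := memLp_stationaryPath hμ hθ hV 0
  have h3 := integral_sq_stationaryPath hμ hθ hV t
  have h4 := integral_sq_stationaryPath hμ hθ hV 0
  have i1 := h1.integrable_sq
  have i2 := h2.integrable_sq
  have h5 : ‖pathAutocov θ μ t‖ ≤
      ∫ f, 1 / 2 * (stationaryPath θ t f ^ 2 + stationaryPath θ 0 f ^ 2) ∂μ := by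
    refine norm_integral_le_of_norm_le ((i1.add i2).const_mul _) (ae_of_all _ fun f ↦ ?_)
    rw [Real.norm_eq_abs, abs_le]
    constructor <;> nlinarith [sq_nonneg (stationaryPath θ t f + stationaryPath θ 0 f),
      sq_nonneg (stationaryPath θ t f - stationaryPath θ 0 f)]
  rw [integral_const_mul, integral_add i1 i2, h3, h4, Real.norm_eq_abs] at h5
  linarith

end CanonicalProcess

/-! ### Ergodic averages of the squared stationary solution -/

section ErgodicAverages

variable {μ : Measure (ContPath ℝ)} [IsProbabilityMeasure μ] {θ : ℝ}

lemma memLp_stationaryPath_sq_sub (hμ : IsGaussianNoise (pathEval (S := ℝ)) μ) (hθ : 0 < θ)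
    (hV : Integrable (pathVariance μ) (expLaw θ)) (c t : ℝ) :
    MemLp (fun f ↦ stationaryPath θ t f ^ 2 - c) 2 μ := by
  have h1 := (memClosedSpan_stationaryPath hμ hθ hV t).integrable_pow_four hμ.gaussian hμ.centered
  have h2 : MemLp (fun f ↦ stationaryPath θ t f ^ 2) 2 μ := by
    refine (memLp_two_iff_integrable_sq
      ((measurable_stationaryPath θ t).pow_const 2).aestronglyMeasurable).2 ?_
    simpa only [← pow_mul] using h1
  exact h2.sub (memLp_const c)

lemma isSquareIntegrableField_stationaryPath_sq_sub
    (hμ : IsGaussianNoise (pathEval (S := ℝ)) μ) (hθ : 0 < θ)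
    (hV : Integrable (pathVariance μ) (expLaw θ)) (c : ℝ) (κ : Measure ℝ) [IsFiniteMeasure κ] :
    IsSquareIntegrableField (fun t f ↦ stationaryPath θ t f ^ 2 - c) μ κ where
  measurable := ((measurable_uncurry_stationaryPath θ).pow_const 2).sub_const c
  memLp t := memLp_stationaryPath_sq_sub hμ hθ hV c t
  integrable := by
    have h (t : ℝ) : ∫ f, (stationaryPath θ t f ^ 2 - c) ^ 2 ∂μ =
        ∫ f, (stationaryPath θ 0 f ^ 2 - c) ^ 2 ∂μ := by
      have h1 := (hμ.measurePreserving_pathShift t).map_eq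
      have h2 : Measurable fun f ↦ (stationaryPath θ 0 f ^ 2 - c) ^ 2 :=
        (((measurable_stationaryPath θ 0).pow_const 2).sub_const c).pow_const 2
      conv_rhs => rw [← h1]
      rw [integral_map (measurable_pathShift t).aemeasurable h2.aestronglyMeasurable]
      simp [stationaryPath_pathShift]
    simp_rw [h]
    exact integrable_const _

/-- The covariance of the squares of the stationary solution, by Isserlis' formula. -/
lemma integral_stationaryPath_sq_sub_mul (hμ : IsGaussianNoise (pathEval (S := ℝ)) μ) (hθ : 0 < θ)
    (hV : Integrable (pathVariance μ) (expLaw θ)) {m : ℝ}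
    (hm : m = 1 / 2 * ∫ a, pathVariance μ a ∂(expLaw θ)) (s t : ℝ) :
    ∫ f, (stationaryPath θ t f ^ 2 - m) * (stationaryPath θ s f ^ 2 - m) ∂μ =
      2 * pathAutocov θ μ (t - s) ^ 2 := by
  have ht := memClosedSpan_stationaryPath hμ hθ hV t
  have hs := memClosedSpan_stationaryPath hμ hθ hV s
  obtain ⟨i1, e1⟩ := ht.integral_sq_mul_sq hμ.gaussian hμ.centered hs
  have i2 := (ht.1.integrable_sq).const_mul m
  have i3 := (hs.1.integrable_sq).const_mul m
  rw [integral_sq_stationaryPath hμ hθ hV t, integral_sq_stationaryPath hμ hθ hV s, ← hm,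
    integral_stationaryPath_mul hμ] at e1
  have h1 (f : ContPath ℝ) : (stationaryPath θ t f ^ 2 - m) * (stationaryPath θ s f ^ 2 - m) =
      stationaryPath θ t f ^ 2 * stationaryPath θ s f ^ 2 - m * stationaryPath θ t f ^ 2 -
        m * stationaryPath θ s f ^ 2 + m ^ 2 := by ring
  have i4 : Integrable (fun f ↦ stationaryPath θ t f ^ 2 * stationaryPath θ s f ^ 2 -
    m * stationaryPath θ t f ^ 2) μ := i1.sub i2
  have i5 : Integrable (fun f ↦ stationaryPath θ t f ^ 2 * stationaryPath θ s f ^ 2 -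
    m * stationaryPath θ t f ^ 2 - m * stationaryPath θ s f ^ 2) μ := i4.sub i3
  simp_rw [h1]
  rw [integral_add i5 (integrable_const _), integral_sub i4 i3, integral_sub i1 i2, e1,
    integral_const_mul, integral_const_mul, integral_sq_stationaryPath hμ hθ hV t,
    integral_sq_stationaryPath hμ hθ hV s, ← hm]
  simp
  ring

lemma intervalIntegrable_pathAutocov (hμ : IsGaussianNoise (pathEval (S := ℝ)) μ) (hθ : 0 < θ)
    (hV : Integrable (pathVariance μ) (expLaw θ)) (a b : ℝ) :
    IntervalIntegrable (pathAutocov θ μ) volume a b := by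
  refine (intervalIntegrable_const (c := 1 / 2 * ∫ a, pathVariance μ a ∂(expLaw θ))).mono_fun'
    measurable_pathAutocov.aestronglyMeasurable (ae_of_all _ fun t ↦ ?_)
  exact abs_pathAutocov_le hμ hθ hV t

/-- One factor of `r²` is bounded by the variance `m`, and `s - t` stays in `[-K, K]`, where `|r|` is
even. -/
lemma setIntegral_pathAutocov_sq_le (hμ : IsGaussianNoise (pathEval (S := ℝ)) μ) (hθ : 0 < θ)
    (hV : Integrable (pathVariance μ) (expLaw θ)) {m : ℝ}
    (hm : m = 1 / 2 * ∫ a, pathVariance μ a ∂(expLaw θ)) {s K : ℝ} (hs : s ∈ Ioc 0 K) :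
    ∫ t in Ioc 0 K, 2 * pathAutocov θ μ (s - t) ^ 2 ≤
      4 * m * ∫ t in (0 : ℝ)..K, |pathAutocov θ μ t| := by
  have hK : 0 ≤ K := hs.1.le.trans hs.2
  have hm0 : 0 ≤ m := by
    rw [hm]
    exact (abs_nonneg _).trans (abs_pathAutocov_le hμ hθ hV 0)
  have hi (a b : ℝ) : IntervalIntegrable (fun t ↦ |pathAutocov θ μ t|) volume a b :=
    (intervalIntegrable_pathAutocov hμ hθ hV a b).abs
  have h1 : ∫ t in (0 : ℝ)..K, 2 * pathAutocov θ μ (s - t) ^ 2 ≤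
      ∫ t in (0 : ℝ)..K, 2 * m * |pathAutocov θ μ (s - t)| := by
    have hb : ∀ t, 2 * pathAutocov θ μ (s - t) ^ 2 ≤ 2 * m * |pathAutocov θ μ (s - t)| := fun t ↦ by
      have h2 := abs_pathAutocov_le hμ hθ hV (s - t)
      rw [← hm] at h2
      rw [← sq_abs]
      nlinarith [abs_nonneg (pathAutocov θ μ (s - t))]
    have i1 : IntervalIntegrable (fun t ↦ 2 * m * |pathAutocov θ μ (s - t)|) volume 0 K := by
      have := ((hi (s - 0) (s - K)).comp_sub_left s).const_mul (2 * m)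
      simpa using this
    refine intervalIntegral.integral_mono_on hK (i1.mono_fun' ?_ (ae_of_all _ fun t ↦ ?_)) i1
      fun t _ ↦ hb t
    · exact (((measurable_pathAutocov.comp (measurable_const.sub measurable_id)).pow_const
        2).const_mul 2).aestronglyMeasurable
    · beta_reduce
      rw [Real.norm_eq_abs, abs_of_nonneg (by positivity)]
      exact hb t
  rw [← intervalIntegral.integral_of_le hK]
  refine h1.trans ?_
  rw [intervalIntegral.integral_const_mul,
    intervalIntegral.integral_comp_sub_left (fun t ↦ |pathAutocov θ μ t|) s, sub_zero]
  have h3 : ∫ t in (s - K)..s, |pathAutocov θ μ t| ≤ ∫ t in (-K)..K, |pathAutocov θ μ t| := by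
    refine intervalIntegral.integral_mono_interval (by linarith [hs.1]) (by linarith) hs.2
      (ae_of_all _ fun t ↦ abs_nonneg _) (hi _ _)
  have h4 : ∫ t in (-K)..K, |pathAutocov θ μ t| = 2 * ∫ t in (0 : ℝ)..K, |pathAutocov θ μ t| := by
    have h5 : ∫ t in (-K)..0, |pathAutocov θ μ t| = ∫ t in (0 : ℝ)..K, |pathAutocov θ μ t| := by
      have h6 := intervalIntegral.integral_comp_neg (a := 0) (b := K)
        (fun t ↦ |pathAutocov θ μ t|)
      simp only [pathAutocov_neg hμ, neg_zero] at h6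
      exact h6.symm
    rw [← intervalIntegral.integral_add_adjacent_intervals (hi (-K) 0) (hi 0 K), h5]
    ring
  nlinarith

/-- The variance of the quadratic averages is controlled by the averages of `|r|`. -/
lemma integral_sq_average_le (hμ : IsGaussianNoise (pathEval (S := ℝ)) μ) (hθ : 0 < θ)
    (hV : Integrable (pathVariance μ) (expLaw θ)) {m : ℝ}
    (hm : m = 1 / 2 * ∫ a, pathVariance μ a ∂(expLaw θ)) {K : ℝ} (hK : 0 ≤ K) :
    ∫ f, (∫ t in Ioc 0 K, (stationaryPath θ t f ^ 2 - m)) ^ 2 ∂μ ≤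
      4 * m * K * ∫ t in (0 : ℝ)..K, |pathAutocov θ μ t| := by
  have hF := isSquareIntegrableField_stationaryPath_sq_sub hμ hθ hV m
    (volume.restrict (Ioc 0 K))
  rw [hF.integral_sq_integral]
  simp_rw [integral_stationaryPath_sq_sub_mul hμ hθ hV hm]
  have h1 : ‖∫ s in Ioc 0 K, ∫ t in Ioc 0 K, 2 * pathAutocov θ μ (s - t) ^ 2‖ ≤
      (4 * m * ∫ t in (0 : ℝ)..K, |pathAutocov θ μ t|) * volume.real (Ioc 0 K) := by
    refine norm_setIntegral_le_of_norm_le_const (by simp) fun s hs ↦ ?_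
    rw [Real.norm_eq_abs, abs_of_nonneg (integral_nonneg fun t ↦ by positivity)]
    exact setIntegral_pathAutocov_sq_le hμ hθ hV hm hs
  rw [Real.volume_real_Ioc_of_le hK, sub_zero] at h1
  refine (le_abs_self _).trans (h1.trans_eq (by ring))

lemma ae_integrableOn_stationaryPath_sq (hμ : IsGaussianNoise (pathEval (S := ℝ)) μ) (hθ : 0 < θ)
    (hV : Integrable (pathVariance μ) (expLaw θ)) :
    ∀ᵐ f ∂μ, ∀ N : ℕ, IntegrableOn (fun t ↦ stationaryPath θ t f ^ 2) (Ioc 0 (N : ℝ)) := by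
  refine ae_all_iff.2 fun N ↦ ?_
  have h := (isSquareIntegrableField_stationaryPath_sq_sub hμ hθ hV 0
    (volume.restrict (Ioc 0 (N : ℝ)))).ae_integrable
  simpa [IntegrableOn] using h

/-- Strong law of large numbers for the squared stationary solution along integer times, from the
pointwise ergodic theorem for the unit shift. -/
theorem ae_tendsto_average_stationaryPath_sq (hμ : IsGaussianNoise (pathEval (S := ℝ)) μ)
    (hθ : 0 < θ) (hV : Integrable (pathVariance μ) (expLaw θ)) {m : ℝ}
    (hm : m = 1 / 2 * ∫ a, pathVariance μ a ∂(expLaw θ))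
    (herg : Tendsto (fun T : ℝ ↦ 1 / T * ∫ t in (0 : ℝ)..T, |pathAutocov θ μ t|) atTop (𝓝 0)) :
    ∀ᵐ f ∂μ, Tendsto (fun N : ℕ ↦ (N : ℝ)⁻¹ * ∫ t in (0 : ℝ)..N, stationaryPath θ t f ^ 2)
      atTop (𝓝 m) := by
  set F : ContPath ℝ → ℝ := fun f ↦ ∫ t in Ioc (0 : ℝ) 1, (stationaryPath θ t f ^ 2 - 0)
  have hF := isSquareIntegrableField_stationaryPath_sq_sub hμ hθ hV 0
    (volume.restrict (Ioc (0 : ℝ) 1))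
  have hFm : Measurable F := hF.measurable_integral
  have hF2 : MemLp F 2 μ := hF.memLp_integral
  have hbirk : ∀ᵐ f ∂μ, ∀ N : ℕ, birkhoffAverage ℝ (pathShift 1) F N f =
      (N : ℝ)⁻¹ * ∫ t in (0 : ℝ)..N, stationaryPath θ t f ^ 2 := by
    filter_upwards [hμ.start_zero, ae_integrableOn_stationaryPath_sq hμ hθ hV] with f hf hint N
    have h1 (k : ℕ) : F ((pathShift 1)^[k] f) =
        ∫ t in (k : ℝ)..(k + 1 : ℕ), stationaryPath θ t f ^ 2 := by
      rw [iterate_pathShift_one k f hf]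
      simp only [F, sub_zero, stationaryPath_pathShift]
      rw [← intervalIntegral.integral_of_le zero_le_one,
        intervalIntegral.integral_comp_add_left (fun t ↦ stationaryPath θ t f ^ 2) (k : ℝ)]
      simp
    rw [birkhoffAverage, birkhoffSum, smul_eq_mul]
    simp_rw [h1]
    rw [intervalIntegral.sum_integral_adjacent_intervals (a := fun k : ℕ ↦ (k : ℝ))]
    · simp
    · intro k _
      rw [intervalIntegrable_iff_integrableOn_Ioc_of_le (by simp)]
      exact (hint (k + 1)).mono_set (Ioc_subset_Ioc_left (Nat.cast_nonneg k))
  have hL2 : Tendsto (fun N : ℕ ↦ ∫ f, (birkhoffAverage ℝ (pathShift 1) F N f - m) ^ 2 ∂μ)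
      atTop (𝓝 0) := by
    have h2 := (herg.comp tendsto_natCast_atTop_atTop).const_mul (4 * m)
    rw [mul_zero] at h2
    refine squeeze_zero' (Eventually.of_forall fun N ↦ integral_nonneg fun f ↦ sq_nonneg _) ?_ h2
    filter_upwards [eventually_gt_atTop 0] with N hN
    have hN' : (0 : ℝ) < N := by exact_mod_cast hN
    have h3 : ∫ f, (birkhoffAverage ℝ (pathShift 1) F N f - m) ^ 2 ∂μ =
        ((N : ℝ)⁻¹) ^ 2 * ∫ f, (∫ t in Ioc 0 (N : ℝ), (stationaryPath θ t f ^ 2 - m)) ^ 2 ∂μ := by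
      rw [← integral_const_mul]
      refine integral_congr_ae ?_
      filter_upwards [hbirk, ae_integrableOn_stationaryPath_sq hμ hθ hV] with f hf hint
      rw [hf N, integral_sub (hint N) (integrable_const _), intervalIntegral.integral_of_le hN'.le]
      simp
      field_simp
    have h4 := integral_sq_average_le hμ hθ hV hm hN'.le
    rw [h3]
    refine (mul_le_mul_of_nonneg_left h4 (by positivity)).trans_eq ?_
    simp only [Function.comp_apply]
    field_simp
  have hconv := ae_tendsto_birkhoffAverage_of_tendsto_integral_sq
    (hμ.measurePreserving_pathShift 1) hF2 hFm hL2
  filter_upwards [hconv, hbirk] with f h1 h2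
  exact h1.congr h2

end ErgodicAverages

/-! ### Pathwise identities, time averages and the function `ψ` -/

section Pathwise

variable {θ : ℝ}

lemma setIntegral_Iic_eq_Ioi (g : ℝ → ℝ) (t : ℝ) :
    ∫ s in Iic t, g s = ∫ a in Ioi (0 : ℝ), g (t - a) := by
  rw [← integral_Ici_eq_integral_Ioi, ← integral_indicator measurableSet_Iic,
    ← integral_indicator measurableSet_Ici, ← integral_sub_left_eq_self _ _ t]
  congr 1
  ext a
  simp [indicator]

lemma integrableOn_Iic_iff_Ioi (g : ℝ → ℝ) (t : ℝ) :
    IntegrableOn g (Iic t) ↔ IntegrableOn (fun a ↦ g (t - a)) (Ioi 0) := by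
  rw [← integrableOn_Ici_iff_integrableOn_Ioi, ← integrable_indicator_iff measurableSet_Iic,
    ← integrable_indicator_iff measurableSet_Ici, ← integrable_comp_sub_left _ t]
  refine integrable_congr (ae_of_all _ fun a ↦ ?_)
  simp [indicator]

lemma integrable_expLaw_comp_sub_iff (hθ : 0 < θ) (g : ℝ → ℝ) (t : ℝ) :
    Integrable (fun a ↦ g (t - a)) (expLaw θ) ↔
      IntegrableOn (fun s ↦ Real.exp (θ * s) * g s) (Iic t) := by
  rw [integrable_expLaw_iff hθ, integrableOn_Iic_iff_Ioi]
  have h (a : ℝ) : θ * Real.exp (-θ * a) * g (t - a) =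
      (θ * Real.exp (-θ * t)) * (Real.exp (θ * (t - a)) * g (t - a)) := by
    rw [mul_assoc, mul_assoc, ← mul_assoc (Real.exp (-θ * t)), ← Real.exp_add]
    congr 3
    ring
  simp_rw [h]
  exact integrable_const_mul_iff (by simp [hθ.ne']) _

/-- Integration by parts form of the stationary solution. -/
lemma stationaryPath_eq (hθ : 0 < θ) (f : ContPath ℝ) (t : ℝ)
    (hf : IntegrableOn (fun s ↦ Real.exp (θ * s) * pathEval s f) (Iic t)) :
    stationaryPath θ t f =
      pathEval t f - θ * (Real.exp (-θ * t) * ∫ s in Iic t, Real.exp (θ * s) * pathEval s f) := by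
  have := isProbabilityMeasure_expLaw hθ
  have h1 := (integrable_expLaw_comp_sub_iff hθ (fun s ↦ pathEval s f) t).2 hf
  rw [stationaryPath, integral_sub (integrable_const _) h1, integral_expLaw hθ
    (fun a ↦ pathEval (t - a) f), setIntegral_Iic_eq_Ioi, ← integral_const_mul,
    ← integral_const_mul]
  congr 1
  · simp
  · refine integral_congr_ae (ae_of_all _ fun a ↦ ?_)
    simp only
    rw [← mul_assoc (Real.exp (-θ * t)), ← Real.exp_add, mul_assoc]
    congr 3
    ring

lemma stationarySolution_eq_mul {Ω : Type*} (G : ℝ → Ω → ℝ) (t : ℝ) (ω : Ω) :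
    stationarySolution θ G t ω =
      G t ω - θ * (Real.exp (-θ * t) * ∫ s in Iic t, Real.exp (θ * s) * G s ω) := by
  rw [stationarySolution]
  congr 2
  rw [← integral_const_mul]
  congr 1
  ext s
  rw [← mul_assoc, ← Real.exp_add]
  congr 2
  ring

lemma zeroSolution_eq_mul {Ω : Type*} (G : ℝ≥0 → Ω → ℝ) (t : ℝ) (ω : Ω) :
    zeroSolution θ G t ω = G t.toNNReal ω -
      θ * (Real.exp (-θ * t) * ∫ s in (0 : ℝ)..t, Real.exp (θ * s) * G s.toNNReal ω) := by
  rw [zeroSolution, langevinSolution, mul_zero, zero_add]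
  congr 2
  rw [← intervalIntegral.integral_const_mul]
  congr 1
  ext s
  rw [← mul_assoc, ← Real.exp_add]
  congr 2
  ring

/-- The growth condition at `-∞` does not depend on the upper end point. -/
lemma integrableOn_Iic_of_zero (f : ContPath ℝ)
    (hf : IntegrableOn (fun s ↦ Real.exp (θ * s) * pathEval s f) (Iic 0)) (t : ℝ) :
    IntegrableOn (fun s ↦ Real.exp (θ * s) * pathEval s f) (Iic t) := by
  have hc : Continuous fun s ↦ Real.exp (θ * s) * pathEval s f :=
    (by fun_prop : Continuous fun s ↦ Real.exp (θ * s)).mul (continuous_pathEval f)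
  rcases le_total t 0 with h | h
  · exact hf.mono_set (Iic_subset_Iic.2 h)
  · rw [← Iic_union_Ioc_eq_Iic h]
    exact hf.union (hc.integrableOn_Ioc)

/-- The solution started from zero and the stationary solution differ by `e^{-θ t}` times the initial
value of the latter. -/
lemma zeroSolution_pathRestrict (hθ : 0 < θ) (f : ContPath ℝ) (hf0 : pathEval 0 f = 0)
    (hf : IntegrableOn (fun s ↦ Real.exp (θ * s) * pathEval s f) (Iic 0)) {t : ℝ} (ht : 0 ≤ t) :
    stationaryPath θ t f =
      zeroSolution θ pathEval t (pathRestrict f) + Real.exp (-θ * t) * stationaryPath θ 0 f := by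
  have ht' := integrableOn_Iic_of_zero f hf t
  rw [stationaryPath_eq hθ f t ht', stationaryPath_eq hθ f 0 hf, zeroSolution_eq_mul, hf0]
  have h1 : ∫ s in (0 : ℝ)..t, Real.exp (θ * s) * pathEval s.toNNReal (pathRestrict f) =
      ∫ s in (0 : ℝ)..t, Real.exp (θ * s) * pathEval s f := by
    refine intervalIntegral.integral_congr fun s hs ↦ ?_
    rw [uIcc_of_le ht] at hs
    simp only [pathEval_pathRestrict, Real.coe_toNNReal s hs.1]
  rw [h1, ← intervalIntegral.integral_Iic_sub_Iic hf ht', pathEval_pathRestrict,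
    Real.coe_toNNReal t ht]
  simp
  ring

lemma continuous_zeroSolution (g : ContPath ℝ≥0) :
    Continuous fun t ↦ zeroSolution θ pathEval t g := by
  have h1 : Continuous fun s : ℝ ↦ pathEval s.toNNReal g :=
    (continuous_pathEval g).comp continuous_real_toNNReal
  have h2 : Continuous fun s : ℝ ↦ Real.exp (θ * s) * pathEval s.toNNReal g :=
    (by fun_prop : Continuous fun s ↦ Real.exp (θ * s)).mul h1
  have h3 : Continuous fun t ↦ ∫ s in (0 : ℝ)..t, Real.exp (θ * s) * pathEval s.toNNReal g :=
    intervalIntegral.continuous_primitive (fun a b ↦ h2.intervalIntegrable a b) 0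
  simp_rw [zeroSolution_eq_mul]
  fun_prop

lemma measurable_zeroSolution (t : ℝ) :
    Measurable fun g : ContPath ℝ≥0 ↦ zeroSolution θ pathEval t g := by
  have h1 : Measurable (Function.uncurry (pathEval (S := ℝ≥0))) :=
    measurable_uncurry_of_continuous_of_measurable continuous_pathEval measurable_pathEval
  have h2 : Measurable fun p : ContPath ℝ≥0 × ℝ ↦
      Real.exp (θ * p.2) * pathEval p.2.toNNReal p.1 := by
    refine Measurable.mul (by fun_prop) ?_
    exact h1.comp ((measurable_real_toNNReal.comp measurable_snd).prodMk measurable_fst)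
  have h3 (s : Set ℝ) : Measurable fun g : ContPath ℝ≥0 ↦
      ∫ u in s, Real.exp (θ * u) * pathEval u.toNNReal g :=
    h2.stronglyMeasurable.integral_prod_right'.measurable
  simp_rw [zeroSolution_eq_mul, intervalIntegral]
  exact (measurable_pathEval _).sub ((((h3 _).sub (h3 _)).const_mul _).const_mul _)

lemma measurable_meanSquare (T : ℝ) :
    Measurable fun g : ContPath ℝ≥0 ↦ meanSquare θ pathEval T g := by
  have h1 : Measurable fun p : ContPath ℝ≥0 × ℝ ↦ zeroSolution θ pathEval p.2 p.1 ^ 2 :=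
    ((measurable_uncurry_of_continuous_of_measurable (u := zeroSolution θ pathEval)
      continuous_zeroSolution measurable_zeroSolution).comp measurable_swap).pow_const 2
  have h2 (s : Set ℝ) : Measurable fun g : ContPath ℝ≥0 ↦
      ∫ u in s, zeroSolution θ pathEval u g ^ 2 :=
    h1.stronglyMeasurable.integral_prod_right'.measurable
  simp_rw [meanSquare, intervalIntegral]
  exact ((h2 _).sub (h2 _)).const_mul _

end Pathwise

section Averages

/-- Convergence of time averages of a nonnegative function along integer times implies convergence
along real times. -/
lemma tendsto_average_of_tendsto_natCast {φ : ℝ → ℝ} (hφ : Continuous φ) (hφ0 : ∀ t, 0 ≤ φ t)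
    {m : ℝ} (h : Tendsto (fun N : ℕ ↦ (N : ℝ)⁻¹ * ∫ t in (0 : ℝ)..N, φ t) atTop (𝓝 m)) :
    Tendsto (fun T : ℝ ↦ 1 / T * ∫ t in (0 : ℝ)..T, φ t) atTop (𝓝 m) := by
  have hmono {a b : ℝ} (ha : 0 ≤ a) (hab : a ≤ b) :
      ∫ t in (0 : ℝ)..a, φ t ≤ ∫ t in (0 : ℝ)..b, φ t :=
    intervalIntegral.integral_mono_interval le_rfl ha hab (ae_of_all _ hφ0)
      (hφ.intervalIntegrable _ _)
  have hfl : Tendsto (fun T : ℝ ↦ ⌊T⌋₊) atTop atTop := tendsto_nat_floor_atTop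
  have hr1 : Tendsto (fun T : ℝ ↦ (⌊T⌋₊ : ℝ) / T) atTop (𝓝 1) := tendsto_nat_floor_div_atTop
  have hr2 : Tendsto (fun T : ℝ ↦ (⌊T⌋₊ : ℝ) / T + 1 / T) atTop (𝓝 1) := by
    simpa using hr1.add (tendsto_inv_atTop_zero (𝕜 := ℝ))
  have hlow := hr1.mul (h.comp hfl)
  have hupp := hr2.mul (h.comp ((tendsto_add_atTop_nat 1).comp hfl))
  rw [one_mul] at hlow hupp
  refine tendsto_of_tendsto_of_tendsto_of_le_of_le' hlow hupp ?_ ?_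
  · filter_upwards [eventually_ge_atTop 1] with T hT
    have hn : (0 : ℝ) < ⌊T⌋₊ := by exact_mod_cast Nat.floor_pos.2 hT
    have hT0 : 0 < T := by linarith
    simp only [Function.comp_apply]
    have h1 := hmono hn.le (Nat.floor_le hT0.le)
    calc (⌊T⌋₊ : ℝ) / T * ((⌊T⌋₊ : ℝ)⁻¹ * ∫ t in (0 : ℝ)..⌊T⌋₊, φ t)
        = 1 / T * ∫ t in (0 : ℝ)..⌊T⌋₊, φ t := by field_simp
      _ ≤ _ := mul_le_mul_of_nonneg_left h1 (by positivity)
  · filter_upwards [eventually_ge_atTop 1] with T hT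
    have hT0 : 0 < T := by linarith
    have h1 := hmono hT0.le (Nat.lt_floor_add_one T).le
    simp only [Function.comp_apply, Nat.cast_add, Nat.cast_one]
    have hn : (0 : ℝ) < (⌊T⌋₊ : ℝ) + 1 := by positivity
    calc 1 / T * ∫ t in (0 : ℝ)..T, φ t
        ≤ 1 / T * ∫ t in (0 : ℝ)..((⌊T⌋₊ : ℝ) + 1), φ t :=
          mul_le_mul_of_nonneg_left h1 (by positivity)
      _ = _ := by field_simp

/-- An exponentially decaying perturbation does not change the limit of the quadratic averages. -/
lemma tendsto_average_sq_of_add_exp {θ ξ m : ℝ} (hθ : 0 < θ) {x : ℝ → ℝ} (hx : Continuous x)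
    (h : Tendsto (fun N : ℕ ↦ (N : ℝ)⁻¹ * ∫ t in (0 : ℝ)..N, (x t + Real.exp (-θ * t) * ξ) ^ 2)
      atTop (𝓝 m)) :
    Tendsto (fun N : ℕ ↦ (N : ℝ)⁻¹ * ∫ t in (0 : ℝ)..N, x t ^ 2) atTop (𝓝 m) := by
  set u : ℝ → ℝ := fun t ↦ x t + Real.exp (-θ * t) * ξ with hu
  have huc : Continuous u := by fun_prop
  set C : ℝ := ξ ^ 2 * (1 / (2 * θ))
  have hexp (N : ℝ) (hN : 0 ≤ N) : ∫ t in (0 : ℝ)..N, Real.exp (-(2 * θ) * t) ≤ 1 / (2 * θ) := by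
    rw [intervalIntegral.integral_of_le hN]
    refine (setIntegral_mono_set (integrableOn_exp_mul_Ioi (by linarith) 0)
      (ae_of_all _ fun t ↦ (Real.exp_pos _).le) Ioc_subset_Ioi_self.eventuallyLE).trans_eq ?_
    rw [integral_exp_mul_Ioi (by linarith)]
    simp
  -- the weight `δ = N^{-1/2}` balances the two error terms
  have hbound (N : ℕ) (hN : 0 < N) :
      |(N : ℝ)⁻¹ * (∫ t in (0 : ℝ)..N, x t ^ 2) -
        (N : ℝ)⁻¹ * ∫ t in (0 : ℝ)..N, u t ^ 2| ≤
        (√N)⁻¹ * ((N : ℝ)⁻¹ * ∫ t in (0 : ℝ)..N, u t ^ 2) + C * ((√N)⁻¹ + (N : ℝ)⁻¹) := by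
    have hN0 : (0 : ℝ) < N := by exact_mod_cast hN
    have hs : 0 < √(N : ℝ) := Real.sqrt_pos.2 hN0
    have hss : √(N : ℝ) * √(N : ℝ) = N := Real.mul_self_sqrt hN0.le
    have hpt (t : ℝ) : |x t ^ 2 - u t ^ 2| ≤
        (√N)⁻¹ * u t ^ 2 + (√N + 1) * ξ ^ 2 * Real.exp (-(2 * θ) * t) := by
      have he : Real.exp (-(2 * θ) * t) = Real.exp (-θ * t) ^ 2 := by
        rw [← Real.exp_nat_mul]
        congr 1
        push_cast
        ring
      set e := Real.exp (-θ * t) * ξ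
      have hxe : x t = u t - e := by simp [hu, e]
      have hd : (√N + 1) * ξ ^ 2 * Real.exp (-(2 * θ) * t) = √N * e ^ 2 + e ^ 2 := by
        rw [he]
        ring
      have hi : (√(N : ℝ))⁻¹ * √(N : ℝ) = 1 := inv_mul_cancel₀ hs.ne'
      have hi0 : 0 < (√(N : ℝ))⁻¹ := inv_pos.2 hs
      have k1 : 0 ≤ (√(N : ℝ))⁻¹ * (u t - √N * e) ^ 2 := by positivity
      have k2 : 0 ≤ (√(N : ℝ))⁻¹ * (u t + √N * e) ^ 2 := by positivity
      have k3 : (√(N : ℝ))⁻¹ * (u t - √N * e) ^ 2 =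
          (√(N : ℝ))⁻¹ * u t ^ 2 - 2 * u t * e + √N * e ^ 2 := by
        linear_combination (-2 * u t * e + √N * e ^ 2) * hi
      have k4 : (√(N : ℝ))⁻¹ * (u t + √N * e) ^ 2 =
          (√(N : ℝ))⁻¹ * u t ^ 2 + 2 * u t * e + √N * e ^ 2 := by
        linear_combination (2 * u t * e + √N * e ^ 2) * hi
      rw [hd, hxe, abs_le]
      constructor <;> nlinarith [sq_nonneg e]
    have i1 : IntervalIntegrable (fun t ↦ x t ^ 2) volume 0 N :=
      (hx.pow 2).intervalIntegrable _ _
    have i2 : IntervalIntegrable (fun t ↦ u t ^ 2) volume 0 N :=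
      (huc.pow 2).intervalIntegrable _ _
    have i3 : IntervalIntegrable (fun t ↦ (√N + 1) * ξ ^ 2 * Real.exp (-(2 * θ) * t))
        volume 0 N := Continuous.intervalIntegrable (by fun_prop) _ _
    have k5 : |∫ t in (0 : ℝ)..N, (x t ^ 2 - u t ^ 2)| ≤
        ∫ t in (0 : ℝ)..N,
          ((√N)⁻¹ * u t ^ 2 + (√N + 1) * ξ ^ 2 * Real.exp (-(2 * θ) * t)) := by
      rw [← Real.norm_eq_abs]
      exact intervalIntegral.norm_integral_le_of_norm_le hN0.le
        (ae_of_all _ fun t _ ↦ hpt t) ((i2.const_mul _).add i3)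
    rw [intervalIntegral.integral_add (i2.const_mul _) i3, intervalIntegral.integral_const_mul,
      intervalIntegral.integral_const_mul] at k5
    rw [← mul_sub, ← intervalIntegral.integral_sub i1 i2, abs_mul, abs_of_pos (inv_pos.2 hN0)]
    have k6 := mul_le_mul_of_nonneg_left (hexp N hN0.le)
      (by positivity : 0 ≤ (√(N : ℝ) + 1) * ξ ^ 2)
    have k7 := mul_le_mul_of_nonneg_left (k5.trans (add_le_add_right k6 _)) (inv_pos.2 hN0).le
    refine k7.trans_eq ?_
    have k8 : (N : ℝ)⁻¹ * √N = (√N)⁻¹ := by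
      rw [← hss]
      field_simp
      rw [Real.sqrt_sq hs.le]
    simp only [C]
    linear_combination (ξ ^ 2 * (1 / (2 * θ))) * k8
  have hinv : Tendsto (fun N : ℕ ↦ (N : ℝ)⁻¹) atTop (𝓝 0) :=
    tendsto_inv_atTop_zero.comp tendsto_natCast_atTop_atTop
  have hsinv : Tendsto (fun N : ℕ ↦ (√(N : ℝ))⁻¹) atTop (𝓝 0) :=
    tendsto_inv_atTop_zero.comp (Real.tendsto_sqrt_atTop.comp tendsto_natCast_atTop_atTop)
  have herr := (hsinv.mul h).add ((hsinv.add hinv).const_mul C)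
  simp only [zero_mul, add_zero, mul_zero] at herr
  have hdiff : Tendsto (fun N : ℕ ↦ (N : ℝ)⁻¹ * (∫ t in (0 : ℝ)..N, x t ^ 2) -
      (N : ℝ)⁻¹ * ∫ t in (0 : ℝ)..N, u t ^ 2) atTop (𝓝 0) := by
    refine squeeze_zero_norm' ?_ herr
    filter_upwards [eventually_gt_atTop 0] with N hN using hbound N hN
  have h' : Tendsto (fun N : ℕ ↦ (N : ℝ)⁻¹ * ∫ t in (0 : ℝ)..N, u t ^ 2) atTop (𝓝 m) := h
  simpa using hdiff.add h'

end Averages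

section Psi

/-- A continuous strictly decreasing function on `(0, ∞)` has a locally continuous inverse; here
for the inverse `Function.invFunOn`. -/
lemma tendsto_invFunOn_of_strictAntiOn {F : ℝ → ℝ} (hF : StrictAntiOn F (Ioi 0))
    (hFc : ContinuousOn F (Ioi 0)) {θ : ℝ} (hθ : 0 < θ) {ι : Type*} {l : Filter ι} {y : ι → ℝ}
    (hy : Tendsto y l (𝓝 (F θ))) :
    (∀ᶠ i in l, y i ∈ F '' Ioi 0) ∧
      Tendsto (fun i ↦ Function.invFunOn F (Ioi 0) (y i)) l (𝓝 θ) := by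
  have key {ε : ℝ} (hε : 0 < ε) (hεθ : ε < θ) :
      ∀ᶠ i in l, ∃ x ∈ Ioo (θ - ε) (θ + ε), x ∈ Ioi 0 ∧ F x = y i := by
    have p1 : θ - ε ∈ Ioi (0 : ℝ) := by simp [hεθ]
    have p2 : θ + ε ∈ Ioi (0 : ℝ) := by simp; linarith
    have h1 : F θ < F (θ - ε) := hF p1 hθ (by linarith)
    have h2 : F (θ + ε) < F θ := hF hθ p2 (by linarith)
    have hsub : Icc (θ - ε) (θ + ε) ⊆ Ioi 0 := fun x hx ↦ lt_of_lt_of_le p1 hx.1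
    filter_upwards [hy.eventually_lt_const h1, hy.eventually_const_lt h2] with i hi1 hi2
    obtain ⟨x, hx, hxy⟩ := intermediate_value_Ioo' (by linarith) (hFc.mono hsub)
      (show y i ∈ Ioo (F (θ + ε)) (F (θ - ε)) from ⟨hi2, hi1⟩)
    exact ⟨x, hx, hsub (Ioo_subset_Icc_self hx), hxy⟩
  have hinv {x z : ℝ} (hx : x ∈ Ioi (0 : ℝ)) (hxz : F x = z) :
      Function.invFunOn F (Ioi 0) z = x := by
    rw [← hxz]
    exact hF.injOn.leftInvOn_invFunOn hx
  refine ⟨?_, ?_⟩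
  · filter_upwards [key (half_pos hθ) (half_lt_self hθ)] with i ⟨x, _, hx, hxy⟩
    exact ⟨x, hx, hxy⟩
  · rw [Metric.tendsto_nhds]
    intro ε hε
    have hε' : 0 < min ε (θ / 2) := lt_min hε (half_pos hθ)
    filter_upwards [key hε' ((min_le_right _ _).trans_lt (half_lt_self hθ))] with i ⟨x, hx, hx0, hxy⟩
    rw [hinv hx0 hxy, Real.dist_eq, abs_lt]
    have := min_le_left ε (θ / 2)
    exact ⟨by linarith [hx.1], by linarith [hx.2]⟩

variable {v : ℝ≥0 → ℝ}

lemma psi_eq (v : ℝ≥0 → ℝ) {θ : ℝ} (hθ : 0 < θ) :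
    psi v θ = 1 / 2 * ∫ u in Ioi (0 : ℝ), Real.exp (-u) * v (u / θ).toNNReal := by
  have h := integral_comp_mul_left_Ioi (fun u ↦ Real.exp (-u) * v (u / θ).toNNReal) 0 hθ
  rw [mul_zero, smul_eq_mul] at h
  rw [psi]
  have h2 : ∫ t in Ioi (0 : ℝ), Real.exp (-θ * t) * v t.toNNReal =
      ∫ x in Ioi (0 : ℝ), Real.exp (-(θ * x)) * v (θ * x / θ).toNNReal := by
    congr 1
    ext t
    rw [mul_div_cancel_left₀ _ hθ.ne', neg_mul]
  rw [h2, h]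
  field_simp

/-- `ψ(θ) = ½ ∫ e^{-u} v(u / θ) du` is strictly decreasing since `v` is strictly increasing. -/
lemma strictAntiOn_psi (hv : StrictMono v)
    (hint : ∀ θ, 0 < θ → IntegrableOn (fun t ↦ Real.exp (-θ * t) * v t.toNNReal) (Ioi 0)) :
    StrictAntiOn (psi v) (Ioi 0) := by
  have hi {θ : ℝ} (hθ : 0 < θ) :
      IntegrableOn (fun u ↦ Real.exp (-u) * v (u / θ).toNNReal) (Ioi 0) := by
    have h := integrableOn_Ioi_comp_mul_left_iff
      (fun u ↦ Real.exp (-u) * v (u / θ).toNNReal) 0 hθ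
    rw [mul_zero] at h
    refine h.1 ((hint θ hθ).congr_fun (fun t _ ↦ ?_) measurableSet_Ioi)
    simp only
    rw [mul_div_cancel_left₀ _ hθ.ne', neg_mul]
  intro a ha b hb hab
  have ha' : (0 : ℝ) < a := ha
  have hb' : (0 : ℝ) < b := hb
  rw [psi_eq v ha', psi_eq v hb']
  have hlt (u : ℝ) (hu : u ∈ Ioi (0 : ℝ)) :
      Real.exp (-u) * v (u / b).toNNReal < Real.exp (-u) * v (u / a).toNNReal := by
    have hu' : (0 : ℝ) < u := hu
    refine mul_lt_mul_of_pos_left (hv ?_) (Real.exp_pos _)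
    exact (Real.toNNReal_lt_toNNReal_iff (by positivity)).2
      (div_lt_div_of_pos_left hu' ha' hab)
  have h : ∫ u in Ioi (0 : ℝ), Real.exp (-u) * v (u / b).toNNReal <
      ∫ u in Ioi (0 : ℝ), Real.exp (-u) * v (u / a).toNNReal := by
    rw [← sub_pos, ← integral_sub (hi ha') (hi hb')]
    refine (integral_pos_iff_support_of_nonneg_ae ?_ ((hi ha').sub (hi hb'))).2 ?_
    · filter_upwards [ae_restrict_mem measurableSet_Ioi] with u hu
      exact (sub_pos.2 (hlt u hu)).le
    · have hsub : Ioi (0 : ℝ) ⊆ Function.support fun u ↦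
          Real.exp (-u) * v (u / a).toNNReal - Real.exp (-u) * v (u / b).toNNReal :=
        fun u hu ↦ (sub_pos.2 (hlt u hu)).ne'
      refine lt_of_lt_of_le ?_ (measure_mono hsub)
      simp
  linarith

lemma continuousOn_psi
    (hint : ∀ θ, 0 < θ → IntegrableOn (fun t ↦ Real.exp (-θ * t) * v t.toNNReal) (Ioi 0)) :
    ContinuousOn (psi v) (Ioi 0) := by
  intro θ hθ
  have hθ' : (0 : ℝ) < θ := hθ
  refine ContinuousAt.continuousWithinAt ?_
  refine ContinuousAt.mul (by fun_prop) ?_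
  refine continuousAt_of_dominated (bound := fun t ↦ |Real.exp (-(θ / 2) * t) * v t.toNNReal|)
    ?_ ?_ (hint (θ / 2) (half_pos hθ')).abs ?_
  · filter_upwards [lt_mem_nhds hθ'] with η hη using (hint η hη).1
  · filter_upwards [lt_mem_nhds (half_lt_self hθ')] with η hη
    filter_upwards [ae_restrict_mem measurableSet_Ioi] with t ht
    have ht' : (0 : ℝ) < t := ht
    rw [Real.norm_eq_abs, abs_mul, abs_mul, Real.abs_exp, Real.abs_exp]
    refine mul_le_mul_of_nonneg_right (Real.exp_le_exp.2 ?_) (abs_nonneg _)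
    nlinarith
  · exact ae_of_all _ fun t ↦ by fun_prop

end Psi

/-! ### Transfer from path space and strong consistency -/

section Transfer

lemma map_restrict_map_contPath {S Ω : Type*} [TopologicalSpace S] [MeasurableSpace Ω]
    {P : Measure Ω} {G : S → Ω → ℝ} {Y : Ω → ContPath S} (hY : Measurable Y)
    (hYG : ∀ᵐ ω ∂P, ∀ t, pathEval t (Y ω) = G t ω) (I : Finset S) :
    (P.map Y).map (fun f ↦ I.restrict fun t ↦ pathEval t f) =
      P.map (fun ω ↦ I.restrict fun t ↦ G t ω) := by
  rw [Measure.map_map (by fun_prop) hY]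
  refine Measure.map_congr ?_
  filter_upwards [hYG] with ω hω
  ext t
  exact hω t

variable {μ : Measure (ContPath ℝ)} [IsProbabilityMeasure μ] {θ : ℝ}

lemma ae_integrableOn_exp_mul_pathEval (hμ : IsGaussianNoise (pathEval (S := ℝ)) μ) (hθ : 0 < θ)
    (hV : Integrable (pathVariance μ) (expLaw θ)) :
    ∀ᵐ f ∂μ, IntegrableOn (fun s ↦ Real.exp (θ * s) * pathEval s f) (Iic 0) := by
  have := isProbabilityMeasure_expLaw hθ
  filter_upwards [(isSquareIntegrableField_increments hμ hV 0).ae_integrable] with f hf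
  refine (integrable_expLaw_comp_sub_iff hθ (fun s ↦ pathEval s f) 0).1 ?_
  refine ((integrable_const (pathEval 0 f)).sub hf).congr (ae_of_all _ fun a ↦ ?_)
  simp

/-- Almost surely, the averages of the squared solution started from zero converge to the
stationary variance. -/
lemma ae_tendsto_meanSquare (hμ : IsGaussianNoise (pathEval (S := ℝ)) μ) (hθ : 0 < θ)
    (hV : Integrable (pathVariance μ) (expLaw θ)) {m : ℝ}
    (hm : m = 1 / 2 * ∫ a, pathVariance μ a ∂(expLaw θ))
    (herg : Tendsto (fun T : ℝ ↦ 1 / T * ∫ t in (0 : ℝ)..T, |pathAutocov θ μ t|) atTop (𝓝 0)) :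
    ∀ᵐ f ∂μ, Tendsto (fun N : ℕ ↦ meanSquare θ pathEval N (pathRestrict f)) atTop (𝓝 m) := by
  filter_upwards [ae_tendsto_average_stationaryPath_sq hμ hθ hV hm herg, hμ.start_zero,
    ae_integrableOn_exp_mul_pathEval hμ hθ hV] with f h1 h2 h3
  have h4 (N : ℕ) : ∫ t in (0 : ℝ)..N, stationaryPath θ t f ^ 2 =
      ∫ t in (0 : ℝ)..N, (zeroSolution θ pathEval t (pathRestrict f) +
        Real.exp (-θ * t) * stationaryPath θ 0 f) ^ 2 := by
    refine intervalIntegral.integral_congr fun t ht ↦ ?_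
    rw [uIcc_of_le (Nat.cast_nonneg N)] at ht
    simp only [zeroSolution_pathRestrict hθ f h2 h3 ht.1]
  simp_rw [h4] at h1
  have h5 := tendsto_average_sq_of_add_exp hθ (continuous_zeroSolution (pathRestrict f)) h1
  simpa [meanSquare] using h5

lemma stationaryAutocov_eq_pathAutocov {Ω' : Type*} [MeasurableSpace Ω'] {P' : Measure Ω'}
    [IsProbabilityMeasure P'] {G' : ℝ → Ω' → ℝ} {Y : Ω' → ContPath ℝ} (hY : Measurable Y)
    (hYG : ∀ᵐ ω ∂P', ∀ t, pathEval t (Y ω) = G' t ω)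
    (hμ : IsGaussianNoise (pathEval (S := ℝ)) (P'.map Y)) (hθ : 0 < θ)
    (hV : Integrable (pathVariance (P'.map Y)) (expLaw θ)) (t : ℝ) :
    stationaryAutocov θ G' P' t = pathAutocov θ (P'.map Y) t := by
  have : IsProbabilityMeasure (P'.map Y) := Measure.isProbabilityMeasure_map hY.aemeasurable
  have h1 (t : ℝ) : stationarySolution θ G' t =ᵐ[P'] fun ω ↦ stationaryPath θ t (Y ω) := by
    filter_upwards [hYG, ae_of_ae_map hY.aemeasurable (ae_integrableOn_exp_mul_pathEval hμ hθ hV)]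
      with ω h2 h3
    rw [stationaryPath_eq hθ _ t (integrableOn_Iic_of_zero _ h3 t), stationarySolution_eq_mul]
    simp_rw [h2]
  have h0 (t : ℝ) : ∫ ω, stationarySolution θ G' t ω ∂P' = 0 := by
    rw [integral_congr_ae (h1 t),
      ← (memClosedSpan_stationaryPath hμ hθ hV t).integral_eq_zero hμ.centered,
      integral_map hY.aemeasurable (measurable_stationaryPath θ t).aestronglyMeasurable]
  have h4 : Measurable fun f ↦ stationaryPath θ t f * stationaryPath θ 0 f :=
    (measurable_stationaryPath _ _).mul (measurable_stationaryPath _ _)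
  rw [stationaryAutocov, covariance, pathAutocov, h0, h0, integral_map hY.aemeasurable
    h4.aestronglyMeasurable]
  refine integral_congr_ae ?_
  filter_upwards [h1 t, h1 0] with ω h5 h6
  rw [h5, h6, sub_zero, sub_zero]

end Transfer

theorem mainTheorem2 {Ω Ω' : Type*} [MeasurableSpace Ω] [MeasurableSpace Ω']
    (P : Measure Ω) [IsProbabilityMeasure P] (P' : Measure Ω') [IsProbabilityMeasure P']
    (θ : ℝ) (hθ : 0 < θ)
    (G : ℝ≥0 → Ω → ℝ) (hG : IsGaussianNoise G P)
    (G' : ℝ → Ω' → ℝ) (hG' : IsNoiseExtension G P G' P')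
    (hergodic : Tendsto (fun T : ℝ ↦ 1 / T * ∫ t in (0 : ℝ)..T, |stationaryAutocov θ G' P' t|)
      atTop (𝓝 0))
    (hv : StrictMono (noiseVariance G P)) :
    InjOn (psi (noiseVariance G P)) (Ioi 0) ∧
    ∀ᵐ ω ∂P,
      (∀ᶠ T : ℝ in atTop, meanSquare θ G T ω ∈ psi (noiseVariance G P) '' Ioi 0) ∧
      Tendsto (fun T : ℝ ↦ alternativeEstimator θ G P T ω) atTop (𝓝 θ) := by
  obtain ⟨Y, hY, hYG⟩ := exists_measurable_contPath hG.gaussian.aemeasurable hG.continuous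
  obtain ⟨Y', hY', hYG'⟩ := exists_measurable_contPath hG'.noise.gaussian.aemeasurable
    hG'.noise.continuous
  set μ : Measure (ContPath ℝ) := P'.map Y' with hμdef
  have : IsProbabilityMeasure μ := Measure.isProbabilityMeasure_map hY'.aemeasurable
  have : IsProbabilityMeasure (P.map Y) := Measure.isProbabilityMeasure_map hY.aemeasurable
  have hμ : IsGaussianNoise (pathEval (S := ℝ)) μ := hG'.noise.map_contPath hY' hYG'
  -- the law of `G` is the image of the law of `G'` under restriction to the half-line
  have hlaw : P.map Y = μ.map pathRestrict := by
    have : IsProbabilityMeasure (μ.map pathRestrict) :=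
      Measure.isProbabilityMeasure_map measurable_pathRestrict.aemeasurable
    refine contPath_measure_ext fun I ↦ ?_
    rw [map_restrict_map_contPath hY hYG I, hμdef, Measure.map_map measurable_pathRestrict hY',
      map_restrict_map_contPath (G := fun (t : ℝ≥0) ω ↦ G' t ω)
        (measurable_pathRestrict.comp hY') (by
          filter_upwards [hYG'] with ω hω t using hω t) I]
    exact (hG'.law_eq I).map_eq
  have hvar (t : ℝ≥0) : noiseVariance G P t = pathVariance μ t := by
    have h1 : Measurable fun g : ContPath ℝ≥0 ↦ pathEval t g ^ 2 := by fun_prop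
    calc noiseVariance G P t = ∫ ω, G t ω ^ 2 ∂P :=
          variance_of_integral_eq_zero (hG.gaussian.aemeasurable t) (hG.centered t)
      _ = ∫ g, pathEval t g ^ 2 ∂(P.map Y) := by
          rw [integral_map hY.aemeasurable h1.aestronglyMeasurable]
          exact integral_congr_ae (by filter_upwards [hYG] with ω hω; rw [hω t])
      _ = pathVariance μ t := by
          rw [hlaw, integral_map measurable_pathRestrict.aemeasurable h1.aestronglyMeasurable]
          rfl
  have hvar' {t : ℝ} (ht : 0 ≤ t) : noiseVariance G P t.toNNReal = pathVariance μ t := by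
    rw [hvar, Real.coe_toNNReal t ht]
  have hmono : MonotoneOn (pathVariance μ) (Ici 0) := fun s hs t ht hst ↦ by
    rw [← hvar' hs, ← hvar' ht]
    exact hv.monotone (Real.toNNReal_le_toNNReal hst)
  have hV {η : ℝ} (hη : 0 < η) : Integrable (pathVariance μ) (expLaw η) :=
    integrable_pathVariance hμ hη hmono
  have hint (η : ℝ) (hη : 0 < η) :
      IntegrableOn (fun t ↦ Real.exp (-η * t) * noiseVariance G P t.toNNReal) (Ioi 0) := by
    have h1 := ((integrable_expLaw_iff hη _).1 (hV hη)).const_mul η⁻¹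
    refine IntegrableOn.congr_fun h1 (fun t ht ↦ ?_) measurableSet_Ioi
    simp only [hvar' (le_of_lt ht)]
    field_simp
  have hanti := strictAntiOn_psi hv hint
  have hcont := continuousOn_psi hint
  have hpsi : psi (noiseVariance G P) θ = 1 / 2 * ∫ a, pathVariance μ a ∂(expLaw θ) := by
    rw [psi, integral_expLaw hθ, div_eq_mul_one_div, mul_comm θ, mul_assoc, ← integral_const_mul]
    congr 1
    refine setIntegral_congr_fun measurableSet_Ioi fun t ht ↦ ?_
    simp only [hvar' (le_of_lt ht), mul_assoc]
  refine ⟨hanti.injOn, ?_⟩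
  simp_rw [stationaryAutocov_eq_pathAutocov hY' hYG' hμ hθ (hV hθ)] at hergodic
  -- the convergence event is measurable on path space, hence transfers from `G'` to `G`
  have hconv : ∀ᵐ ω ∂P, Tendsto (fun N : ℕ ↦ meanSquare θ pathEval N (Y ω)) atTop
      (𝓝 (psi (noiseVariance G P) θ)) := by
    refine ae_of_ae_map (p := fun g ↦ Tendsto (fun N : ℕ ↦ meanSquare θ pathEval N g) atTop
      (𝓝 (psi (noiseVariance G P) θ))) hY.aemeasurable ?_
    rw [hlaw]
    refine (ae_map_iff measurable_pathRestrict.aemeasurable ?_).2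
      (ae_tendsto_meanSquare hμ hθ (hV hθ) hpsi hergodic)
    exact measurableSet_tendsto _ fun N ↦ measurable_meanSquare N
  filter_upwards [hconv, hYG] with ω h1 h2
  have h3 (T : ℝ) : meanSquare θ G T ω = meanSquare θ pathEval T (Y ω) := by
    simp only [meanSquare, zeroSolution, langevinSolution, h2]
  have h4 : Tendsto (fun T : ℝ ↦ meanSquare θ G T ω) atTop
      (𝓝 (psi (noiseVariance G P) θ)) := by
    simp_rw [h3]
    refine tendsto_average_of_tendsto_natCast ((continuous_zeroSolution (Y ω)).pow 2)
      (fun t ↦ sq_nonneg _) ?_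
    simpa [meanSquare] using h1
  exact tendsto_invFunOn_of_strictAntiOn hanti hcont hθ h4
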